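/- **Closed form of the single layer integral for two triangles with a common edge.** *The integrals.* Let $p,u,v,w\in\mathbb R^3$, let $\pi=\{(x_1,x_2): 0<x_1<1,\ 0<x_2<x_1\}$, and let $$\chi_\tau(y)=p+y_1v+y_2u,\qquad \chi_\sigma(x)=p+x_1v+x_2w,\qquad \tau=\chi_\tau(\pi),\quad \sigma=\chi_\sigma(\pi),$$ so that $\tau$ and $\sigma$ are the open flat triangles with vertices $p,\,p+v,\,p+v+u$ and $p,\,p+v,\,p+v+w$. Put $g_\tau=\sqrt{\det(J_\tau^\top J_\tau)}$, $J_\tau=(v\mid u)$, and $g_\sigma=\sqrt{\det(J_\sigma^\top J_\sigma)}$, $J_\sigma=(v\mid w)$. Assume $g_\tau\ne0$, $g_\sigma\neq 0$ and that the closed triangles intersect exactly in the edge from $p$ to $p+v$, i.e. $\bar\tau\cap\bar\sigma=[p,p+v]$. Let $$I=\int_\sigma\int_\tau\frac{1}{4\pi|y-x|}\,dS(y)\,dS(x)$$ and $$I_1=\int_{(0,1)^2}\frac{d(\eta_3,\eta_4)}{|\eta_3(u+v)+\eta_4w-u|},\qquad I_2=\int_{(0,1)^2}\frac{\eta_3\,d(\eta_3,\eta_4)}{|\eta_4\eta_3(u+v)-\eta_3u+w|},\qquad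 I_3=\int_{(0,1)^2}\frac{\eta_3\,d(\eta_3,\eta_4)}{|\eta_4\eta_3(w+v)-\eta_3w+u|},$$ $$I_4=\int_{(0,1)^2}\frac{\eta_3\,d(\eta_3,\eta_4)}{|\eta_4\eta_3u+\eta_3(w+v)-w|},\qquad I_5=\int_{(0,1)^2}\frac{\eta_3\,d(\eta_3,\eta_4)}{|\eta_4\eta_3(w+v)+\eta_3u-w|}.$$ *The integral $H$ and its closed form $\mathcal H$.* For $a,b,c\in\mathbb R^3$ with $c\ne0$ let $\hat c=c/|c|$, $$h(\eta)=\frac{(\eta a+b)\cdot b+|\eta a+b|\;b\cdot\hat c}{|\eta a+b|^2+|\eta a+b|\,(\eta a+b)\cdot\hat c},\qquad H(a,b,c)=\int_0^1h(\eta)\,d\eta .$$ Call $(a,b,c)$ *regular* if $|\eta a+b|+(\eta a+b)\cdot\hat c\ne0$ for all $\eta\in(0,1]$, i.e. if the denominator of $h$ has no zero in $(0,1]$. Define $\mathcal H(a,b,c)$ as follows. If $a=0$, then $\mathcal H=1$. If $a\ne0$, put $p=a\cdot b/|a|^2$ and $q=\sqrt{|b|^2/|a|^2-p^2}$ (here $p$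 is a number). If $q=0$, then $\mathcal H=p\ln(1+1/p)$ (to be read as $0$ if $p=0$). If $q>0$, put $$\begin{aligned} \alpha_0&=q|a|+(b-pa)\cdot\hat c,&\alpha_1&=2q\,a\cdot\hat c,&\alpha_2&=q|a|+(pa-b)\cdot\hat c,\\ \beta_0&=b\cdot\hat c+q|a|,&\beta_1&=2p|a|,&\beta_2&=b\cdot\hat c-q|a|,\\ \gamma_1&=\tfrac12\,\frac{\beta_0+\beta_1+\beta_2}{\alpha_0+\alpha_1+\alpha_2},&\gamma_2&=\tfrac12\,\frac{\beta_0-\beta_1+\beta_2}{\alpha_0-\alpha_1+\alpha_2},&\gamma_3&=\beta_0-(\gamma_1+\gamma_2)\alpha_0,\quad\gamma_4=\alpha_2(\gamma_1-\gamma_2), \end{aligned}$$ where $\gamma_1$ (resp. $\gamma_2$) is set to $0$ if its denominator vanishes, let $D=4\alpha_0\alpha_2-\alpha_1^2$, $$F(t)=\gamma_2\ln|1+t|-\gamma_1\ln|1-t|,$$ $$G(t)=\begin{cases}\dfrac{\gamma_4}{2\alpha_2}\ln|\alpha_0+\alpha_1t+\alpha_2t^2|+\dfrac{2\gamma_3\alpha_2-\gamma_4\alpha_1}{\alpha_2\sqrt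 D}\arctan\dfrac{\alpha_1+2\alpha_2t}{\sqrt D},&D>0,\\[2ex] \dfrac{\gamma_4}{\alpha_2}\ln\Big|t+\dfrac{\alpha_1}{2\alpha_2}\Big|-\dfrac{2\gamma_3\alpha_2-\gamma_4\alpha_1}{\alpha_2(2\alpha_2t+\alpha_1)},&D=0,\end{cases}$$ where $G$ is set to $0$ if $\alpha_2=0$ or if $\gamma_3=\gamma_4=0$, and $$t_0=\frac{p}{q+\sqrt{p^2+q^2}},\qquad t_1=\frac{p+1}{q+\sqrt{(p+1)^2+q^2}},\qquad \mathcal H(a,b,c)=2q\,\big(F(t_1)-F(t_0)+G(t_1)-G(t_0)\big).$$ *The formulas for $I_j$.* Let $(a_j,b_j,c_j)$ be given by | $j$ | $a_j$ | $b_j$ | $c_j$ | |---|---|---|---| | $1$ | $w$ | $v$ | $u+v$ | | $2$ | $v$ | $w$ | $u+v$ | | $3$ | $v$ | $u$ | $w+v$ | | $4$ | $u+v+w$ | $-w$ | $u$ | | $5$ | $u+v+w$ | $-w$ | $v+w$ | and let $(a_1',b_1')=(a_1,b_1-c_1)$ and $(a_j',b_j')=(a_j-c_j,b_j)$ for $j=2,\dots,5$.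 For $K\in\{H,\mathcal H\}$ consider the formula $$I_j=\frac1{|c_j|}\ln\frac{|a_j+b_j||c_j|+(a_j+b_j)\cdot c_j}{|a_j+b_j-c_j||c_j|+(a_j+b_j-c_j)\cdot c_j}-\frac1{|c_j|}\Big(K(a_j',b_j',c_j)-K(a_j,b_j,c_j)\Big).\tag{$*$}$$ **Statement.** 1. For all $a,b,c\in\mathbb R^3$ with $c\ne0$: if $a\neq0$ then $D\ge0$; and if $(a,b,c)$ is regular, then $h$ is integrable on $(0,1)$ and $H(a,b,c)=\mathcal H(a,b,c)$. 2. For two triangles as above, the kernel $1/(4\pi|y-x|)$ is integrable on $\sigma\times\tau$, the five integrands of $I_1,\dots,I_5$ are integrable on $(0,1)^2$, and $$I=\frac{g_\tau g_\sigma}{24\pi}\sum_{j=1}^5I_j .$$ 3. For two triangles as above and every $j\in\{1,\dots,5\}$ for which numerator and denominator under the logarithm in $(*)$ are positive, $(*)$ holds with $K=\mathcal H$. They are positive for all $j$ unless $p$ lies on the segment joining the two opposite vertices $p+v+u$ and $p+v+w$. 4. For two triangles as above and every $j$ for which $(a_j,b_j,c_j)$ and $(a_j',b_j',c_j)$ are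 regular, $(*)$ holds with $K=H$. This is the case for all $j$ if $u,v,w$ are linearly independent, i.e. if the triangles are not coplanar. -/

import Mathlib

open MeasureTheory

namespace SingleLayerEdge

noncomputable section

/-- Euclidean three-space. -/
abbrev E3 : Type := EuclideanSpace ℝ (Fin 3)

/-- The reference triangle `{0 < x₁ < 1, 0 < x₂ < x₁}`. -/
def refTriangle : Set (ℝ × ℝ) := {x | 0 < x.1 ∧ x.1 < 1 ∧ 0 < x.2 ∧ x.2 < x.1}

/-- The reference mapping `χ(x) = p + x₁ e + x₂ f`. -/
def chi (p e f : E3) (x : ℝ × ℝ) : E3 := p + x.1 • e + x.2 • f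

/-- The (open, flat) triangle with vertices `p`, `p + e`, `p + e + f`. -/
def triangle (p e f : E3) : Set E3 := chi p e f '' refTriangle

/-- The corresponding closed triangle. -/
def closedTriangle (p e f : E3) : Set E3 := convexHull ℝ {p, p + e, p + e + f}

/-- The Jacobian `J = (e | f)` of the reference mapping. -/
def jacobian (e f : E3) : Matrix (Fin 3) (Fin 2) ℝ := Matrix.of fun i k => ![e i, f i] k

/-- The Gram determinant `g = √(det(Jᵀ J))` of the reference mapping. -/
def gramRoot (e f : E3) : ℝ := √((jacobian e f).transpose * jacobian e f).det

/-- The fundamental solution of the Laplace operator. -/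
def fundSol (x y : E3) : ℝ := 1 / (4 * Real.pi * ‖y - x‖)

/-- `∫_σ ∫_τ u*(x, y) dS(y) dS(x)`, the surface measure `dS` being the two-dimensional
Hausdorff measure, normalised to agree with Lebesgue measure on Euclidean planes. -/
def singleLayer (σ τ : Set E3) : ℝ :=
  ∫ x in σ, (∫ y in τ, fundSol x y ∂(μHE[2] : Measure E3)) ∂(μHE[2] : Measure E3)

/-- The five integrands on `(0,1)²` of the regularised integral; the point is `(η₃, η₄)` and the
index `j : Fin 5` stands for the `(j+1)`-st integral. -/
def edgeIntegrand (u v w : E3) (j : Fin 5) (z : ℝ × ℝ) : ℝ :=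
  ![1 / ‖z.1 • (u + v) + z.2 • w - u‖,
    z.1 / ‖(z.2 * z.1) • (u + v) - z.1 • u + w‖,
    z.1 / ‖(z.2 * z.1) • (w + v) - z.1 • w + u‖,
    z.1 / ‖(z.2 * z.1) • u + z.1 • (w + v) - w‖,
    z.1 / ‖(z.2 * z.1) • (w + v) + z.1 • u - w‖] j

/-- The open unit square. -/
def unitSquare : Set (ℝ × ℝ) := Set.Ioo 0 1 ×ˢ Set.Ioo 0 1

/-- The integrals `I₁, …, I₅`. -/
def edgeIntegral (u v w : E3) (j : Fin 5) : ℝ := ∫ z in unitSquare, edgeIntegrand u v w j z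

/-! ### The integrand `h` and the function `H` -/

/-- `ĉ = c / |c|`. -/
def hat (c : E3) : E3 := ‖c‖⁻¹ • c

/-- The integrand `h(η)` with parameters `a, b, c`. -/
def hFun (a b c : E3) (η : ℝ) : ℝ :=
  (inner ℝ (η • a + b) b + ‖η • a + b‖ * inner ℝ b (hat c)) /
    (‖η • a + b‖ ^ 2 + ‖η • a + b‖ * inner ℝ (η • a + b) (hat c))

/-- `H(a, b, c) = ∫₀¹ h(η) dη`. -/
def hIntegral (a b c : E3) : ℝ := ∫ η in (0 : ℝ)..1, hFun a b c η

/-- No point `η a + b` with `0 < η ≤ 1` lies on the ray `{-t c : t ≥ 0}`; equivalently, the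
denominator of `h` has no zero in `(0, 1]`. -/
def Regular (a b c : E3) : Prop :=
  ∀ η ∈ Set.Ioc (0 : ℝ) 1, ‖η • a + b‖ + inner ℝ (η • a + b) (hat c) ≠ 0

/-! ### The closed form of `H` -/

def pPar (a b : E3) : ℝ := inner ℝ a b / ‖a‖ ^ 2

def qPar (a b : E3) : ℝ := √(‖b‖ ^ 2 / ‖a‖ ^ 2 - pPar a b ^ 2)

def alpha0 (a b c : E3) : ℝ := qPar a b * ‖a‖ + inner ℝ (-(pPar a b • a) + b) (hat c)

def alpha1 (a b c : E3) : ℝ := 2 * qPar a b * inner ℝ a (hat c)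

def alpha2 (a b c : E3) : ℝ := qPar a b * ‖a‖ + inner ℝ (pPar a b • a - b) (hat c)

def beta0 (a b c : E3) : ℝ := inner ℝ b (hat c) + qPar a b * ‖a‖

def beta1 (a b : E3) : ℝ := 2 * pPar a b * ‖a‖

def beta2 (a b c : E3) : ℝ := inner ℝ b (hat c) - qPar a b * ‖a‖

/-- In the degenerate case `α₀ + α₁ + α₂ = 0` the numerator vanishes as well and the coefficient
is `0` by the convention `x / 0 = 0`; the partial fraction decomposition stays correct. -/
def gamma1 (a b c : E3) : ℝ :=
  1 / 2 * ((beta0 a b c + beta1 a b + beta2 a b c) / (alpha0 a b c + alpha1 a b c + alpha2 a b c))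

/-- As for `gamma1`, the value is `0` in the degenerate case `α₀ - α₁ + α₂ = 0`. -/
def gamma2 (a b c : E3) : ℝ :=
  1 / 2 * ((beta0 a b c - beta1 a b + beta2 a b c) / (alpha0 a b c - alpha1 a b c + alpha2 a b c))

def gamma3 (a b c : E3) : ℝ := beta0 a b c - (gamma1 a b c + gamma2 a b c) * alpha0 a b c

def gamma4 (a b c : E3) : ℝ := alpha2 a b c * (gamma1 a b c - gamma2 a b c)

/-- The discriminant `D = 4 α₀ α₂ - α₁²`. -/
def disc (a b c : E3) : ℝ := 4 * alpha0 a b c * alpha2 a b c - alpha1 a b c ^ 2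

/-- Anti-derivative of `γ₁ / (1 - t) + γ₂ / (1 + t)`. -/
def antiF (a b c : E3) (t : ℝ) : ℝ :=
  gamma2 a b c * Real.log |1 + t| - gamma1 a b c * Real.log |1 - t|

/-- Anti-derivative of `(γ₃ + γ₄ t) / (α₀ + α₁ t + α₂ t²)`. The numerator is identically zero,
and `antiF` alone is the anti-derivative, if `α₂ = 0` or if `γ₃ = γ₄ = 0`; `G = 0` then. -/
def antiG (a b c : E3) (t : ℝ) : ℝ :=
  if alpha2 a b c = 0 ∨ (gamma3 a b c = 0 ∧ gamma4 a b c = 0) then 0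
  else if 0 < disc a b c then
    gamma4 a b c / (2 * alpha2 a b c) *
        Real.log |alpha0 a b c + alpha1 a b c * t + alpha2 a b c * t ^ 2| +
      (2 * gamma3 a b c * alpha2 a b c - gamma4 a b c * alpha1 a b c) /
          (alpha2 a b c * √(disc a b c)) *
        Real.arctan ((alpha1 a b c + 2 * alpha2 a b c * t) / √(disc a b c))
  else
    gamma4 a b c / alpha2 a b c * Real.log |t + alpha1 a b c / (2 * alpha2 a b c)| -
      (2 * gamma3 a b c * alpha2 a b c - gamma4 a b c * alpha1 a b c) /
        (alpha2 a b c * (2 * alpha2 a b c * t + alpha1 a b c))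

/-- `t₀`. -/
def tZero (a b : E3) : ℝ := pPar a b / (qPar a b + √(pPar a b ^ 2 + qPar a b ^ 2))

/-- `t₁`. -/
def tOne (a b : E3) : ℝ :=
  (pPar a b + 1) / (qPar a b + √((pPar a b + 1) ^ 2 + qPar a b ^ 2))

open Classical in
/-- The closed form of `H(a, b, c)`. For `a = 0` (where `p`, `q` are undefined) `h` is constantly
`1`. For `q = 0 = p`, that is `b = 0`, the value of `p ln(1 + 1/p)` is `0`. -/
def hClosed (a b c : E3) : ℝ :=
  if a = 0 then 1
  else if qPar a b = 0 then pPar a b * Real.log (1 + 1 / pPar a b)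
  else 2 * qPar a b * (antiF a b c (tOne a b) - antiF a b c (tZero a b)
    + antiG a b c (tOne a b) - antiG a b c (tZero a b))

/-! ### The closed form of the integrals `I₁, …, I₅` -/

/-- The vectors `a` for `j = 1, …, 5`. -/
def parA (u v w : E3) : Fin 5 → E3 := ![w, v, v, u + v + w, u + v + w]

/-- The vectors `b` for `j = 1, …, 5`. -/
def parB (u v w : E3) : Fin 5 → E3 := ![v, w, u, -w, -w]

/-- The vectors `c` for `j = 1, …, 5`. -/
def parC (u v w : E3) : Fin 5 → E3 := ![u + v, u + v, w + v, u, v + w]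

/-- The first argument of the subtracted `H`: `a` for `I₁`, and `a - c` for `I₂, …, I₅`. -/
def parA' (u v w : E3) (j : Fin 5) : E3 :=
  if j = 0 then parA u v w j else parA u v w j - parC u v w j

/-- The second argument of the subtracted `H`: `b - c` for `I₁`, and `b` for `I₂, …, I₅`. -/
def parB' (u v w : E3) (j : Fin 5) : E3 :=
  if j = 0 then parB u v w j - parC u v w j else parB u v w j

/-- `|x| |c| + x · c`. -/
def logArg (x c : E3) : ℝ := ‖x‖ * ‖c‖ + inner ℝ x c

/-- Numerator and denominator of the quotient under the logarithm are positive. -/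
def LogDefined (u v w : E3) (j : Fin 5) : Prop :=
  0 < logArg (parA u v w j + parB u v w j) (parC u v w j) ∧
    0 < logArg (parA u v w j + parB u v w j - parC u v w j) (parC u v w j)

/-- The two integrals `H` that occur for `I_j` have integrands without a pole. -/
def RegularPair (u v w : E3) (j : Fin 5) : Prop :=
  Regular (parA u v w j) (parB u v w j) (parC u v w j) ∧
    Regular (parA' u v w j) (parB' u v w j) (parC u v w j)

/-- The right-hand side of the formula for `I_j`, with `H` as a parameter:
`ln(…) / |c| - (H(a, b - c, c) - H(a, b, c)) / |c|` for `j = 1` and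
`ln(…) / |c| - (H(a - c, b, c) - H(a, b, c)) / |c|` for `j = 2, …, 5`. -/
def edgeFormula (H : E3 → E3 → E3 → ℝ) (u v w : E3) (j : Fin 5) : ℝ :=
  1 / ‖parC u v w j‖ *
      Real.log (logArg (parA u v w j + parB u v w j) (parC u v w j) /
        logArg (parA u v w j + parB u v w j - parC u v w j) (parC u v w j)) -
    1 / ‖parC u v w j‖ *
      (H (parA' u v w j) (parB' u v w j) (parC u v w j) -
        H (parA u v w j) (parB u v w j) (parC u v w j))

end

end SingleLayerEdge

open SingleLayerEdge

/-!
For regular `(a, b, c)` the substitution `η + p = 2 q t / (1 - t²)`, i.e. `t = tan (θ / 2)` where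
`η + p = q tan θ`, makes `|η a + b|` and hence `h` rational in `t`. The partial fractions of the
result with respect to the poles `t = ±1` and the quadratic `α₀ + α₁ t + α₂ t²` are integrated
explicitly.

The integrand `1 / |η a + b + ξ c|` of a square integral has the antiderivative
`ln (|x| |c| + x · c) / |c|` in `ξ`, and a further integration by parts in `η` turns the integral of
this logarithm into boundary terms and the integral of `1 - h`.

In relative coordinates the kernel on a pair of triangles with a common edge is homogeneous of
degree `-1`. Scaling by the largest coordinate of each of five cones in parameter space
(translation along the edge accounts for one more coordinate) leaves integrals over `(0,1)²`, the
radial integrals `∫ t² dt` and `∫ t dt` giving the common factor `1/6`.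
-/

namespace SingleLayerEdge

open Set Filter Topology

/-! ### Antiderivatives of rational functions and the half-angle substitution -/

section Quadratic

variable {α₀ α₁ α₂ t : ℝ}

lemma hasDerivAt_quadratic :
    HasDerivAt (fun t => α₀ + α₁ * t + α₂ * t ^ 2) (α₁ + 2 * α₂ * t) t := by
  refine ((((hasDerivAt_id t).const_mul α₁).const_add α₀).add
    ((hasDerivAt_pow 2 t).const_mul α₂)).congr_deriv ?_
  norm_num
  ring

lemma hasDerivAt_log_add_arctan (γ₃ γ₄ : ℝ) (hD : 0 < 4 * α₀ * α₂ - α₁ ^ 2) :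
    HasDerivAt (fun t => γ₄ / (2 * α₂) * Real.log |α₀ + α₁ * t + α₂ * t ^ 2| +
        (2 * γ₃ * α₂ - γ₄ * α₁) / (α₂ * √(4 * α₀ * α₂ - α₁ ^ 2)) *
          Real.arctan ((α₁ + 2 * α₂ * t) / √(4 * α₀ * α₂ - α₁ ^ 2)))
      ((γ₃ + γ₄ * t) / (α₀ + α₁ * t + α₂ * t ^ 2)) t := by
  set r := √(4 * α₀ * α₂ - α₁ ^ 2)
  have hr : 0 < r := Real.sqrt_pos.2 hD
  have hr2 : r ^ 2 = 4 * α₀ * α₂ - α₁ ^ 2 := Real.sq_sqrt hD.le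
  have hα : α₂ ≠ 0 := by rintro rfl; nlinarith
  have hsq : 4 * α₂ * (α₀ + α₁ * t + α₂ * t ^ 2) = r ^ 2 + (α₁ + 2 * α₂ * t) ^ 2 := by
    rw [hr2]; ring
  have hquad : α₀ + α₁ * t + α₂ * t ^ 2 ≠ 0 := by
    intro h
    rw [h, mul_zero] at hsq
    have : 0 < r ^ 2 + (α₁ + 2 * α₂ * t) ^ 2 := by positivity
    exact this.ne hsq
  have harctan : 1 + ((α₁ + 2 * α₂ * t) / r) ^ 2 =
      4 * α₂ * (α₀ + α₁ * t + α₂ * t ^ 2) / r ^ 2 := by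
    rw [hsq]; field_simp
  have hlin : HasDerivAt (fun t => (α₁ + 2 * α₂ * t) / r) (2 * α₂ / r) t := by
    simpa only [mul_one, id] using
      (((hasDerivAt_id t).const_mul (2 * α₂)).const_add α₁).div_const r
  simp_rw [Real.log_abs]
  refine (((hasDerivAt_quadratic.log hquad).const_mul _).add
    (hlin.arctan.const_mul _)).congr_deriv ?_
  rw [harctan]
  field_simp
  ring

lemma hasDerivAt_log_sub_div (γ₃ γ₄ : ℝ) (hD : 4 * α₀ * α₂ - α₁ ^ 2 = 0)
    (hquad : α₀ + α₁ * t + α₂ * t ^ 2 ≠ 0) (hα : α₂ ≠ 0) :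
    HasDerivAt (fun t => γ₄ / α₂ * Real.log |t + α₁ / (2 * α₂)| -
        (2 * γ₃ * α₂ - γ₄ * α₁) / (α₂ * (2 * α₂ * t + α₁)))
      ((γ₃ + γ₄ * t) / (α₀ + α₁ * t + α₂ * t ^ 2)) t := by
  have hsq : α₀ + α₁ * t + α₂ * t ^ 2 = (2 * α₂ * t + α₁) ^ 2 / (4 * α₂) := by
    field_simp; linear_combination hD
  have hlin : 2 * α₂ * t + α₁ ≠ 0 := by
    intro h; rw [hsq, h] at hquad; norm_num at hquad
  have hmonic : t + α₁ / (2 * α₂) = (2 * α₂ * t + α₁) / (2 * α₂) := by field_simp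
  have dlog : HasDerivAt (fun t => Real.log (t + α₁ / (2 * α₂))) (1 / (t + α₁ / (2 * α₂))) t :=
    ((hasDerivAt_id t).add_const _).log (by rw [id, hmonic]; positivity)
  have dinv : HasDerivAt (fun t => (2 * γ₃ * α₂ - γ₄ * α₁) / (α₂ * (2 * α₂ * t + α₁)))
      (-((2 * γ₃ * α₂ - γ₄ * α₁) * (α₂ * (2 * α₂))) / (α₂ * (2 * α₂ * t + α₁)) ^ 2) t := by
    have dlin : HasDerivAt (fun t => α₂ * (2 * α₂ * t + α₁)) (α₂ * (2 * α₂)) t := by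
      simpa only [mul_one, id] using
        (((hasDerivAt_id t).const_mul (2 * α₂)).add_const α₁).const_mul α₂
    simpa only [zero_mul, zero_sub] using
      (hasDerivAt_const t (2 * γ₃ * α₂ - γ₄ * α₁)).fun_div dlin (mul_ne_zero hα hlin)
  simp_rw [Real.log_abs]
  refine ((dlog.const_mul (γ₄ / α₂)).sub dinv).congr_deriv ?_
  rw [hsq, hmonic]
  field_simp
  ring

end Quadratic

/-- `tan (θ / 2)` for `s = q tan θ`, the inverse of the rationalising substitution
`s = 2 q t / (1 - t²)`. -/
noncomputable def tanHalf (q s : ℝ) : ℝ := s / (q + √(s ^ 2 + q ^ 2))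

section TanHalf

variable {q : ℝ} (hq : 0 < q) (s : ℝ)
include hq

lemma sqrt_sq_add_sq_pos : 0 < √(s ^ 2 + q ^ 2) := Real.sqrt_pos.2 (by positivity)

lemma one_sub_sq_tanHalf : 1 - tanHalf q s ^ 2 = 2 * q / (q + √(s ^ 2 + q ^ 2)) := by
  have := sqrt_sq_add_sq_pos hq s
  have h2 : √(s ^ 2 + q ^ 2) ^ 2 = s ^ 2 + q ^ 2 := Real.sq_sqrt (by positivity)
  unfold tanHalf
  field_simp
  linear_combination h2

lemma one_sub_sq_tanHalf_pos : 0 < 1 - tanHalf q s ^ 2 := by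
  have := sqrt_sq_add_sq_pos hq s
  rw [one_sub_sq_tanHalf hq]; positivity

lemma tanHalf_lt_one : tanHalf q s < 1 := by nlinarith [one_sub_sq_tanHalf_pos hq s]

lemma neg_one_lt_tanHalf : -1 < tanHalf q s := by nlinarith [one_sub_sq_tanHalf_pos hq s]

lemma mul_one_add_sq_tanHalf :
    q * (1 + tanHalf q s ^ 2) = (1 - tanHalf q s ^ 2) * √(s ^ 2 + q ^ 2) := by
  have h := one_sub_sq_tanHalf hq s
  have h1 := sqrt_sq_add_sq_pos hq s
  rw [eq_div_iff (by positivity)] at h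
  linear_combination -h

lemma two_mul_mul_tanHalf : 2 * q * tanHalf q s = (1 - tanHalf q s ^ 2) * s := by
  have := sqrt_sq_add_sq_pos hq s
  rw [one_sub_sq_tanHalf hq, tanHalf]
  field_simp

lemma hasDerivAt_tanHalf :
    HasDerivAt (tanHalf q) ((1 - tanHalf q s ^ 2) / (2 * √(s ^ 2 + q ^ 2))) s := by
  have := sqrt_sq_add_sq_pos hq s
  have h2 : √(s ^ 2 + q ^ 2) ^ 2 = s ^ 2 + q ^ 2 := Real.sq_sqrt (by positivity)
  have d : HasDerivAt (fun s : ℝ => √(s ^ 2 + q ^ 2)) (s / √(s ^ 2 + q ^ 2)) s := by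
    refine (((hasDerivAt_pow 2 s).add_const (q ^ 2)).sqrt (by positivity)).congr_deriv ?_
    norm_num
    field_simp
  refine ((hasDerivAt_id s).div (d.const_add q) (by positivity)).congr_deriv ?_
  rw [one_sub_sq_tanHalf hq, id]
  field_simp
  linear_combination h2

lemma continuous_tanHalf : Continuous (tanHalf q) :=
  continuous_iff_continuousAt.2 fun s => (hasDerivAt_tanHalf hq s).continuousAt

end TanHalf

/-! ### Lines in space and the argument of the logarithm -/

lemma norm_sq_mul_inner_sq_add_le {E : Type*} [NormedAddCommGroup E] [InnerProductSpace ℝ E]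
    {x y : E} (hxy : inner ℝ x y = 0) (e : E) :
    ‖y‖ ^ 2 * inner ℝ x e ^ 2 + ‖x‖ ^ 2 * inner ℝ y e ^ 2 ≤ ‖x‖ ^ 2 * ‖y‖ ^ 2 * ‖e‖ ^ 2 := by
  set S := ‖y‖ ^ 2 * inner ℝ x e ^ 2 + ‖x‖ ^ 2 * inner ℝ y e ^ 2 with hS
  set z := (‖y‖ ^ 2 * inner ℝ x e) • x + (‖x‖ ^ 2 * inner ℝ y e) • y with hz
  have hze : inner ℝ z e = S := by
    rw [hz, hS, inner_add_left, real_inner_smul_left, real_inner_smul_left]; ring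
  have hzz : inner ℝ z z = ‖x‖ ^ 2 * ‖y‖ ^ 2 * S := by
    simp only [hz, hS, inner_add_left, inner_add_right, real_inner_smul_left,
      real_inner_smul_right, real_inner_self_eq_norm_sq, hxy, real_inner_comm x y,
      norm_smul, mul_pow, Real.norm_eq_abs, sq_abs]
    ring
  have cauchy_schwarz : S * S ≤ ‖x‖ ^ 2 * ‖y‖ ^ 2 * ‖e‖ ^ 2 * S := by
    have h := real_inner_mul_inner_self_le z e
    rw [hze, hzz, real_inner_self_eq_norm_sq] at h
    linarith
  rcases (show 0 ≤ S by positivity).eq_or_lt with h0 | hpos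
  · rw [← h0]; positivity
  · exact le_of_mul_le_mul_right cauchy_schwarz hpos

lemma inner_eq_pPar {a : E3} (ha : a ≠ 0) (b : E3) : inner ℝ a b = pPar a b * ‖a‖ ^ 2 := by
  have : ‖a‖ ≠ 0 := norm_ne_zero_iff.2 ha
  rw [pPar]; field_simp

lemma pPar_neg (a b : E3) : pPar (-a) b = -pPar a b := by
  rw [pPar, pPar, inner_neg_left, norm_neg, neg_div]

lemma qPar_neg (a b : E3) : qPar (-a) b = qPar a b := by
  rw [qPar, qPar, pPar_neg, norm_neg, neg_sq]

lemma qPar_nonneg (a b : E3) : 0 ≤ qPar a b := Real.sqrt_nonneg _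

lemma inner_sub_pPar_smul {a : E3} (ha : a ≠ 0) (b : E3) : inner ℝ (b - pPar a b • a) a = 0 := by
  rw [inner_sub_left, real_inner_smul_left, real_inner_comm, inner_eq_pPar ha,
    real_inner_self_eq_norm_sq, sub_self]

lemma norm_sq_eq_norm_sub_pPar_smul_sq_add {a : E3} (ha : a ≠ 0) (b : E3) :
    ‖b‖ ^ 2 = ‖b - pPar a b • a‖ ^ 2 + pPar a b ^ 2 * ‖a‖ ^ 2 := by
  rw [norm_sub_sq_real, real_inner_smul_right, real_inner_comm, inner_eq_pPar ha, norm_smul,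
    mul_pow, Real.norm_eq_abs, sq_abs]
  ring

lemma norm_sub_pPar_smul {a : E3} (ha : a ≠ 0) (b : E3) :
    ‖b - pPar a b • a‖ = qPar a b * ‖a‖ := by
  have hn : 0 < ‖a‖ := norm_pos_iff.2 ha
  have : ‖b‖ ^ 2 / ‖a‖ ^ 2 - pPar a b ^ 2 = (‖b - pPar a b • a‖ / ‖a‖) ^ 2 := by
    rw [norm_sq_eq_norm_sub_pPar_smul_sq_add ha]; field_simp; ring
  rw [qPar, this, Real.sqrt_sq (by positivity), div_mul_cancel₀ _ hn.ne']

lemma norm_sq_eq_pPar_qPar {a : E3} (ha : a ≠ 0) (b : E3) :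
    ‖b‖ ^ 2 = ‖a‖ ^ 2 * (pPar a b ^ 2 + qPar a b ^ 2) := by
  rw [norm_sq_eq_norm_sub_pPar_smul_sq_add ha, norm_sub_pPar_smul ha]; ring

lemma eq_pPar_smul_of_qPar_eq_zero {a b : E3} (ha : a ≠ 0) (hq : qPar a b = 0) :
    b = pPar a b • a := by
  rw [← sub_eq_zero, ← norm_eq_zero, norm_sub_pPar_smul ha, hq, zero_mul]

lemma norm_smul_add {a : E3} (ha : a ≠ 0) (b : E3) (η : ℝ) :
    ‖η • a + b‖ = ‖a‖ * √((η + pPar a b) ^ 2 + qPar a b ^ 2) := by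
  rw [← sq_eq_sq₀ (norm_nonneg _) (by positivity), mul_pow, Real.sq_sqrt (by positivity),
    norm_add_sq_real, norm_smul, real_inner_smul_left, inner_eq_pPar ha,
    norm_sq_eq_pPar_qPar ha b, mul_pow, Real.norm_eq_abs, sq_abs]
  ring

lemma norm_smul_add_pos {a b : E3} (ha : a ≠ 0) (hq : 0 < qPar a b) (η : ℝ) :
    0 < ‖η • a + b‖ := by
  rw [norm_smul_add ha]
  exact mul_pos (norm_pos_iff.2 ha) (sqrt_sq_add_sq_pos hq _)

lemma norm_hat {c : E3} (hc : c ≠ 0) : ‖hat c‖ = 1 := norm_smul_inv_norm hc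

lemma inner_eq_norm_mul_inner_hat {c : E3} (hc : c ≠ 0) (x : E3) :
    inner ℝ x c = ‖c‖ * inner ℝ x (hat c) := by
  rw [hat, real_inner_smul_right, mul_inv_cancel_left₀ (norm_ne_zero_iff.2 hc)]

lemma logArg_eq {c : E3} (hc : c ≠ 0) (x : E3) :
    logArg x c = ‖c‖ * (‖x‖ + inner ℝ x (hat c)) := by
  rw [logArg, inner_eq_norm_mul_inner_hat hc]; ring

lemma logArg_eq_zero_iff_norm_add {c : E3} (hc : c ≠ 0) (x : E3) :
    logArg x c = 0 ↔ ‖x‖ + inner ℝ x (hat c) = 0 := by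
  rw [logArg_eq hc, mul_eq_zero, or_iff_right (norm_ne_zero_iff.2 hc)]

lemma logArg_nonneg (x c : E3) : 0 ≤ logArg x c := by
  have := neg_le_of_abs_le (abs_real_inner_le_norm x c)
  rw [logArg]; linarith

lemma logArg_eq_zero_iff_eq_hat {c : E3} (hc : c ≠ 0) (x : E3) :
    logArg x c = 0 ↔ x = -(‖x‖ • hat c) := by
  have antiparallel : logArg x c = 0 ↔ inner ℝ (-x) (hat c) = ‖-x‖ * ‖hat c‖ := by
    rw [logArg_eq_zero_iff_norm_add hc, inner_neg_left, norm_neg, norm_hat hc, mul_one,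
      neg_eq_iff_add_eq_zero, add_comm]
  rw [antiparallel, inner_eq_norm_mul_iff_real, norm_hat hc, one_smul, norm_neg,
    neg_eq_iff_eq_neg]

lemma logArg_eq_zero_iff {c : E3} (hc : c ≠ 0) (x : E3) :
    logArg x c = 0 ↔ ∃ l : ℝ, 0 ≤ l ∧ x = -(l • c) := by
  constructor
  · intro h
    refine ⟨‖x‖ * ‖c‖⁻¹, by positivity, ?_⟩
    rwa [mul_smul, ← hat, ← logArg_eq_zero_iff_eq_hat hc]
  · rintro ⟨l, hl, rfl⟩
    rw [logArg, norm_neg, norm_smul, Real.norm_of_nonneg hl, inner_neg_left,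
      real_inner_smul_left, real_inner_self_eq_norm_sq]
    ring

lemma logArg_pos_iff {c : E3} (hc : c ≠ 0) (x : E3) :
    0 < logArg x c ↔ ∀ l : ℝ, 0 ≤ l → x ≠ -(l • c) := by
  rw [(logArg_nonneg x c).lt_iff_ne', Ne, logArg_eq_zero_iff hc]
  push Not
  rfl

lemma logArg_zero_left (c : E3) : logArg 0 c = 0 := by
  rw [logArg, norm_zero, inner_zero_left, zero_mul, add_zero]

@[fun_prop]
lemma continuous_logArg (c : E3) : Continuous fun x => logArg x c := by
  unfold logArg; fun_prop

lemma inner_add_norm_mul_inner_hat_eq_zero {c : E3} (hc : c ≠ 0) {x : E3} (hx : logArg x c = 0)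
    (y : E3) : inner ℝ x y + ‖x‖ * inner ℝ y (hat c) = 0 := by
  nth_rw 1 [(logArg_eq_zero_iff_eq_hat hc x).1 hx]
  rw [inner_neg_left, real_inner_smul_left, real_inner_comm, neg_add_cancel]

lemma regular_iff {a b c : E3} (hc : c ≠ 0) :
    Regular a b c ↔ ∀ η ∈ Ioc (0 : ℝ) 1, 0 < logArg (η • a + b) c :=
  forall₂_congr fun η _ => by
    rw [(logArg_nonneg _ c).lt_iff_ne', Ne, Ne, logArg_eq_zero_iff_norm_add hc]

/-! ### The coefficients of the closed form -/

/-- The quadratic denominator `α₀ + α₁ t + α₂ t²` of the rationalised integrand. -/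
noncomputable def quadA (a b c : E3) (t : ℝ) : ℝ :=
  alpha0 a b c + alpha1 a b c * t + alpha2 a b c * t ^ 2

lemma alpha0_eq (a b c : E3) : alpha0 a b c =
    qPar a b * ‖a‖ + (inner ℝ b (hat c) - pPar a b * inner ℝ a (hat c)) := by
  rw [alpha0, inner_add_left, inner_neg_left, real_inner_smul_left]; ring

lemma alpha2_eq (a b c : E3) : alpha2 a b c =
    qPar a b * ‖a‖ - (inner ℝ b (hat c) - pPar a b * inner ℝ a (hat c)) := by
  rw [alpha2, inner_sub_left, real_inner_smul_left]; ring

lemma quadA_one (a b c : E3) :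
    quadA a b c 1 = 2 * qPar a b * (‖a‖ + inner ℝ a (hat c)) := by
  rw [quadA, alpha0_eq, alpha1, alpha2_eq]; ring

lemma beta_sum_eq (a b c : E3) :
    beta0 a b c + beta1 a b + beta2 a b c = 2 * (inner ℝ b (hat c) + pPar a b * ‖a‖) := by
  rw [beta0, beta1, beta2]; ring

lemma alpha0_eq_of_alpha2_eq_zero {a b c : E3} (h : alpha2 a b c = 0) :
    alpha0 a b c = 2 * qPar a b * ‖a‖ := by
  rw [alpha2_eq] at h; rw [alpha0_eq]; linarith

lemma alpha1_neg (a b c : E3) : alpha1 (-a) b c = -alpha1 a b c := by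
  rw [alpha1, alpha1, qPar_neg, inner_neg_left, mul_neg]

lemma alpha0_neg (a b c : E3) : alpha0 (-a) b c = alpha0 a b c := by
  rw [alpha0_eq, alpha0_eq, qPar_neg, pPar_neg, norm_neg, inner_neg_left, neg_mul_neg]

lemma alpha2_neg (a b c : E3) : alpha2 (-a) b c = alpha2 a b c := by
  rw [alpha2_eq, alpha2_eq, qPar_neg, pPar_neg, norm_neg, inner_neg_left, neg_mul_neg]

lemma gamma1_neg (a b c : E3) : gamma1 (-a) b c = gamma2 a b c := by
  rw [gamma1, gamma2, alpha0_neg, alpha1_neg, alpha2_neg, beta0, beta1, beta2, beta0, beta1,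
    beta2, qPar_neg, pPar_neg, norm_neg]
  ring

lemma disc_nonneg {a : E3} (ha : a ≠ 0) (b : E3) {c : E3} (hc : c ≠ 0) : 0 ≤ disc a b c := by
  have bessel := norm_sq_mul_inner_sq_add_le (inner_sub_pPar_smul ha b) (hat c)
  rw [norm_sub_pPar_smul ha, norm_hat hc, inner_sub_left, real_inner_smul_left] at bessel
  have hn : 0 < ‖a‖ ^ 2 := pow_pos (norm_pos_iff.2 ha) 2
  refine nonneg_of_mul_nonneg_right (b := disc a b c) ?_ hn
  rw [disc, alpha0_eq, alpha2_eq, alpha1]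
  linarith

section PartialFractions

variable {a b c : E3} (ha : a ≠ 0) (hc : c ≠ 0)
include ha hc

/-- If the left-hand factor vanishes, `a` points in the direction `-c` and both sides are `0`. -/
lemma norm_add_mul_gamma1 (hq : 0 < qPar a b) :
    2 * qPar a b * (‖a‖ + inner ℝ a (hat c)) * gamma1 a b c =
      inner ℝ b (hat c) + pPar a b * ‖a‖ := by
  have hsum : alpha0 a b c + alpha1 a b c + alpha2 a b c =
      2 * qPar a b * (‖a‖ + inner ℝ a (hat c)) := by
    rw [← quadA_one, quadA]; ring
  rw [gamma1, hsum, beta_sum_eq]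
  by_cases h : ‖a‖ + inner ℝ a (hat c) = 0
  · have hn : ‖a‖ ≠ 0 := norm_ne_zero_iff.2 ha
    have hb := inner_add_norm_mul_inner_hat_eq_zero hc
      ((logArg_eq_zero_iff_norm_add hc a).2 h) b
    rw [inner_eq_pPar ha] at hb
    rw [h, mul_zero, zero_mul]
    refine mul_left_cancel₀ hn ?_
    linarith
  · field_simp

lemma norm_sub_mul_gamma2 (hq : 0 < qPar a b) :
    2 * qPar a b * (‖a‖ - inner ℝ a (hat c)) * gamma2 a b c =
      inner ℝ b (hat c) - pPar a b * ‖a‖ := by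
  have h := norm_add_mul_gamma1 (neg_ne_zero.2 ha) hc (b := b) (by rwa [qPar_neg])
  rwa [gamma1_neg, qPar_neg, pPar_neg, norm_neg, inner_neg_left, neg_mul, ← sub_eq_add_neg,
    ← sub_eq_add_neg] at h

lemma partial_fraction (hq : 0 < qPar a b) (t : ℝ) :
    beta0 a b c + beta1 a b * t + beta2 a b c * t ^ 2 =
      gamma1 a b c * (1 + t) * quadA a b c t + gamma2 a b c * (1 - t) * quadA a b c t +
        (gamma3 a b c + gamma4 a b c * t) * (1 - t ^ 2) := by
  have at_one := norm_add_mul_gamma1 ha hc hq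
  have at_neg_one := norm_sub_mul_gamma2 ha hc hq
  rw [quadA, gamma3, gamma4, beta0, beta1, beta2, alpha0_eq, alpha1, alpha2_eq]
  linear_combination -(t + t ^ 2) * at_one - (t ^ 2 - t) * at_neg_one

lemma alpha1_eq_zero_of_alpha2_eq_zero (h : alpha2 a b c = 0) : alpha1 a b c = 0 := by
  have := disc_nonneg ha b hc
  rw [disc, h] at this
  nlinarith

lemma gamma3_gamma4_eq_zero_of_alpha2_eq_zero (hq : 0 < qPar a b) (h : alpha2 a b c = 0) :
    gamma3 a b c = 0 ∧ gamma4 a b c = 0 := by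
  have hn : 0 < ‖a‖ := norm_pos_iff.2 ha
  have hac : inner ℝ a (hat c) = 0 := by
    have := alpha1_eq_zero_of_alpha2_eq_zero ha hc h
    rw [alpha1] at this
    exact (mul_eq_zero.1 this).resolve_left (by positivity)
  have h1 := norm_add_mul_gamma1 ha hc hq
  have h2 := norm_sub_mul_gamma2 ha hc hq
  rw [hac] at h1 h2
  have hb : inner ℝ b (hat c) = qPar a b * ‖a‖ := by
    rw [alpha2_eq, hac] at h; linarith
  refine ⟨?_, by rw [gamma4, h, zero_mul]⟩
  rw [gamma3, alpha0_eq_of_alpha2_eq_zero h, beta0]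
  linarith

lemma disc_eq_zero_of_quadA_eq_zero {t : ℝ} (hA : quadA a b c t = 0) :
    disc a b c = 0 ∧ 2 * alpha2 a b c * t + alpha1 a b c = 0 := by
  have hD := disc_nonneg ha b hc
  have completed_square : (2 * alpha2 a b c * t + alpha1 a b c) ^ 2 + disc a b c = 0 := by
    rw [quadA] at hA; rw [disc]; linear_combination 4 * alpha2 a b c * hA
  constructor <;> nlinarith [sq_nonneg (2 * alpha2 a b c * t + alpha1 a b c)]

end PartialFractions

/-! ### The antiderivative of `h` -/

lemma hasDerivAt_antiF (a b c : E3) {t : ℝ} (h1 : -1 < t) (h2 : t < 1) :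
    HasDerivAt (antiF a b c) (gamma1 a b c / (1 - t) + gamma2 a b c / (1 + t)) t := by
  have e1 : HasDerivAt (fun t : ℝ => Real.log |1 + t|) (1 / (1 + t)) t := by
    simp_rw [Real.log_abs]
    exact ((hasDerivAt_id t).const_add 1).log (show 1 + t ≠ 0 by linarith)
  have e2 : HasDerivAt (fun t : ℝ => Real.log |1 - t|) (-1 / (1 - t)) t := by
    simp_rw [Real.log_abs]
    exact ((hasDerivAt_id t).const_sub 1).log (show 1 - t ≠ 0 by linarith)
  refine ((e1.const_mul (gamma2 a b c)).sub (e2.const_mul (gamma1 a b c))).congr_deriv ?_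
  ring

lemma antiG_eq_zero {a b c : E3} (h : gamma3 a b c = 0 ∧ gamma4 a b c = 0) (t : ℝ) :
    antiG a b c t = 0 := if_pos (Or.inr h)

lemma hasDerivAt_antiG {a b c : E3} (ha : a ≠ 0) (hq : 0 < qPar a b) (hc : c ≠ 0) {t : ℝ}
    (ht : quadA a b c t ≠ 0) :
    HasDerivAt (antiG a b c) ((gamma3 a b c + gamma4 a b c * t) / quadA a b c t) t := by
  by_cases h : alpha2 a b c = 0 ∨ (gamma3 a b c = 0 ∧ gamma4 a b c = 0)
  · have hγ := h.elim (gamma3_gamma4_eq_zero_of_alpha2_eq_zero ha hc hq) id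
    rw [funext (antiG_eq_zero hγ), hγ.1, hγ.2, zero_mul, add_zero, zero_div]
    exact hasDerivAt_const t 0
  have hα : alpha2 a b c ≠ 0 := fun h' => h (Or.inl h')
  unfold antiG
  simp only [if_neg h]
  rcases (disc_nonneg ha b hc).eq_or_lt with hD | hD
  · simp only [← hD, lt_self_iff_false, if_false]
    exact hasDerivAt_log_sub_div _ _ hD.symm ht hα
  · simp only [hD, if_true]
    exact hasDerivAt_log_add_arctan _ _ hD

/-- The rationalising variable `t` as a function of `η`. -/
noncomputable def tPar (a b : E3) (η : ℝ) : ℝ := tanHalf (qPar a b) (η + pPar a b)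

lemma tZero_eq (a b : E3) : tZero a b = tPar a b 0 := by rw [tZero, tPar, tanHalf, zero_add]

lemma tOne_eq (a b : E3) : tOne a b = tPar a b 1 := by rw [tOne, tPar, tanHalf, add_comm 1]

lemma hFun_eq_div (a b c : E3) (η : ℝ) : hFun a b c η =
    (inner ℝ (η • a + b) b + ‖η • a + b‖ * inner ℝ b (hat c)) /
    (‖η • a + b‖ * (‖η • a + b‖ + inner ℝ (η • a + b) (hat c))) := by
  rw [hFun]; ring_nf

section Antiderivative

variable {a b : E3} (hq : 0 < qPar a b)
include hq

lemma tPar_lt_one (η : ℝ) : tPar a b η < 1 := tanHalf_lt_one hq _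

lemma neg_one_lt_tPar (η : ℝ) : -1 < tPar a b η := neg_one_lt_tanHalf hq _

lemma one_sub_sq_tPar_pos (η : ℝ) : 0 < 1 - tPar a b η ^ 2 := one_sub_sq_tanHalf_pos hq _

lemma continuous_tPar : Continuous (tPar a b) :=
  (continuous_tanHalf hq).comp (continuous_id.add continuous_const)

lemma hasDerivAt_tPar (ha : a ≠ 0) (η : ℝ) :
    HasDerivAt (tPar a b) ((1 - tPar a b η ^ 2) * ‖a‖ / (2 * ‖η • a + b‖)) η := by
  have : 0 < ‖a‖ := norm_pos_iff.2 ha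
  have := sqrt_sq_add_sq_pos hq (η + pPar a b)
  refine (HasDerivAt.comp_add_const η (pPar a b)
    (hasDerivAt_tanHalf hq (η + pPar a b))).congr_deriv ?_
  rw [norm_smul_add ha, tPar]
  field_simp

lemma quadA_tPar (ha : a ≠ 0) (c : E3) (η : ℝ) : quadA a b c (tPar a b η) =
    (1 - tPar a b η ^ 2) * (‖η • a + b‖ + inner ℝ (η • a + b) (hat c)) := by
  have h1 := mul_one_add_sq_tanHalf hq (η + pPar a b)
  have h2 := two_mul_mul_tanHalf hq (η + pPar a b)
  rw [norm_smul_add ha, inner_add_left, real_inner_smul_left, quadA, alpha0_eq, alpha1,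
    alpha2_eq, tPar]
  linear_combination ‖a‖ * h1 + inner ℝ a (hat c) * h2

lemma beta_tPar (ha : a ≠ 0) (c : E3) (η : ℝ) :
    qPar a b * ‖a‖ *
        (beta0 a b c + beta1 a b * tPar a b η + beta2 a b c * tPar a b η ^ 2) =
      (1 - tPar a b η ^ 2) *
        (inner ℝ (η • a + b) b + ‖η • a + b‖ * inner ℝ b (hat c)) := by
  have h1 := mul_one_add_sq_tanHalf hq (η + pPar a b)
  have h2 := two_mul_mul_tanHalf hq (η + pPar a b)
  rw [norm_smul_add ha, inner_add_left, real_inner_smul_left, inner_eq_pPar ha,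
    real_inner_self_eq_norm_sq, norm_sq_eq_pPar_qPar ha b, beta0, beta1, beta2, tPar]
  linear_combination ‖a‖ * inner ℝ b (hat c) * h1 + pPar a b * ‖a‖ ^ 2 * h2

lemma hasDerivAt_antiF_tPar (ha : a ≠ 0) (c : E3) (η : ℝ) :
    HasDerivAt (fun η => 2 * qPar a b * antiF a b c (tPar a b η))
      (qPar a b * ‖a‖ / ‖η • a + b‖ *
        (gamma1 a b c * (1 + tPar a b η) + gamma2 a b c * (1 - tPar a b η))) η := by
  have h1 : 1 - tPar a b η ≠ 0 := by have := tPar_lt_one hq η; linarith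
  have h2 : 1 + tPar a b η ≠ 0 := by have := neg_one_lt_tPar hq η; linarith
  have hx := (norm_smul_add_pos ha hq η).ne'
  refine (((hasDerivAt_antiF a b c (neg_one_lt_tPar hq η) (tPar_lt_one hq η)).comp η
    (hasDerivAt_tPar hq ha η)).const_mul (2 * qPar a b)).congr_deriv ?_
  field_simp
  ring

lemma hasDerivAt_antiF_add_antiG (ha : a ≠ 0) {c : E3} (hc : c ≠ 0) {η : ℝ}
    (hL : logArg (η • a + b) c ≠ 0) :
    HasDerivAt (fun η => 2 * qPar a b * (antiF a b c (tPar a b η) + antiG a b c (tPar a b η)))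
      (hFun a b c η) η := by
  have hx := (norm_smul_add_pos ha hq η).ne'
  have hn : ‖a‖ ≠ 0 := norm_ne_zero_iff.2 ha
  have ht := (one_sub_sq_tPar_pos hq η).ne'
  have hLhat := (logArg_eq_zero_iff_norm_add hc _).not.1 hL
  have hA := quadA_tPar hq ha c η
  have hA0 : quadA a b c (tPar a b η) ≠ 0 := by rw [hA]; exact mul_ne_zero ht hLhat
  have dG := ((hasDerivAt_antiG ha hq hc hA0).comp η (hasDerivAt_tPar hq ha η)).const_mul
    (2 * qPar a b)
  simp_rw [mul_add]
  refine ((hasDerivAt_antiF_tPar hq ha c η).add dG).congr_deriv ?_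
  have hβ := beta_tPar hq ha c η
  have rationalised : hFun a b c η * ‖η • a + b‖ * quadA a b c (tPar a b η) =
      qPar a b * ‖a‖ *
        (beta0 a b c + beta1 a b * tPar a b η + beta2 a b c * tPar a b η ^ 2) := by
    rw [hFun_eq_div, hA, hβ]; field_simp
  rw [partial_fraction ha hc hq] at rationalised
  refine mul_right_cancel₀ (mul_ne_zero hx hA0) ?_
  rw [← mul_assoc (hFun a b c η), rationalised]
  field_simp

end Antiderivative

/-! ### The double zero of the denominator -/

section Root

variable {a b c : E3} (ha : a ≠ 0) (hq : 0 < qPar a b) (hc : c ≠ 0)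
include ha hq hc

lemma quadA_tPar_eq_zero {η : ℝ} (hL : logArg (η • a + b) c = 0) :
    quadA a b c (tPar a b η) = 0 := by
  rw [quadA_tPar hq ha, (logArg_eq_zero_iff_norm_add hc _).1 hL, mul_zero]

lemma alpha2_ne_zero_of_quadA_eq_zero {t : ℝ} (hA : quadA a b c t = 0) : alpha2 a b c ≠ 0 := by
  intro h
  rw [quadA, h, alpha1_eq_zero_of_alpha2_eq_zero ha hc h, alpha0_eq_of_alpha2_eq_zero h] at hA
  have : 0 < ‖a‖ := norm_pos_iff.2 ha
  have : 0 < 2 * qPar a b * ‖a‖ := by positivity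
  linarith

lemma gamma3_add_gamma4_mul_tPar_eq_zero {η : ℝ} (hL : logArg (η • a + b) c = 0) :
    gamma3 a b c + gamma4 a b c * tPar a b η = 0 := by
  have : 0 < ‖a‖ := norm_pos_iff.2 ha
  have hpf := partial_fraction ha hc hq (tPar a b η)
  have hβ := beta_tPar hq ha c η
  rw [inner_add_norm_mul_inner_hat_eq_zero hc hL, mul_zero, hpf,
    quadA_tPar_eq_zero ha hq hc hL, mul_zero, mul_zero, zero_add, zero_add] at hβ
  exact (mul_eq_zero.1 ((mul_eq_zero.1 hβ).resolve_left (by positivity))).resolve_right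
    (one_sub_sq_tPar_pos hq η).ne'

lemma qPar_mul_gamma1_sub_gamma2 {η : ℝ} (hL : logArg (η • a + b) c = 0) :
    qPar a b * (gamma1 a b c - gamma2 a b c) = -η := by
  have hn : 0 < ‖a‖ := norm_pos_iff.2 ha
  have hR := sqrt_sq_add_sq_pos hq (η + pPar a b)
  have hR2 : √((η + pPar a b) ^ 2 + qPar a b ^ 2) ^ 2 = _ := Real.sq_sqrt (by positivity)
  have along_c := (logArg_eq_zero_iff_norm_add hc _).1 hL
  have h := inner_add_norm_mul_inner_hat_eq_zero hc hL a
  rw [inner_add_left, real_inner_smul_left, norm_smul_add ha] at along_c h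
  rw [real_inner_self_eq_norm_sq, real_inner_comm, inner_eq_pPar ha] at h
  set R := √((η + pPar a b) ^ 2 + qPar a b ^ 2)
  have along_a : (η + pPar a b) * ‖a‖ = -(R * inner ℝ a (hat c)) :=
    mul_left_cancel₀ hn.ne' (by linear_combination h)
  have h1 := norm_add_mul_gamma1 ha hc hq
  have h2 := norm_sub_mul_gamma2 ha hc hq
  have not_parallel : ‖a‖ ^ 2 - inner ℝ a (hat c) ^ 2 ≠ 0 := by
    have : R ^ 2 * (‖a‖ ^ 2 - inner ℝ a (hat c) ^ 2) = qPar a b ^ 2 * ‖a‖ ^ 2 := by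
      linear_combination
        ((η + pPar a b) * ‖a‖ - R * inner ℝ a (hat c)) * along_a + ‖a‖ ^ 2 * hR2
    exact right_ne_zero_of_mul (this.trans_ne (by positivity))
  refine mul_left_cancel₀ not_parallel ?_
  linear_combination (‖a‖ - inner ℝ a (hat c)) / 2 * h1 - (‖a‖ + inner ℝ a (hat c)) / 2 * h2
    - inner ℝ a (hat c) * along_c + ‖a‖ * along_a

end Root

/-! ### The closed form of `H` -/

lemma intervalIntegrable_and_integral_eq_sub_of_hasDerivAt {f g Φ : ℝ → ℝ} {a b : ℝ}
    (hg : ContinuousOn g (uIcc a b)) (hΦ : ∀ η ∈ uIcc a b, HasDerivAt Φ (g η) η)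
    (hfg : EqOn f g (uIoc a b)) :
    IntervalIntegrable f volume a b ∧ ∫ η in a..b, f η = Φ b - Φ a := by
  refine ⟨hg.intervalIntegrable.congr hfg.symm, ?_⟩
  rw [intervalIntegral.integral_congr_ae (ae_of_all _ hfg)]
  exact intervalIntegral.integral_eq_sub_of_hasDerivAt hΦ hg.intervalIntegrable

lemma forall_mem_uIcc_zero_one {P : ℝ → Prop} (h0 : P 0) (h : ∀ η ∈ Ioc (0 : ℝ) 1, P η) :
    ∀ η ∈ uIcc (0 : ℝ) 1, P η := by
  intro η hη
  rw [uIcc_of_le zero_le_one] at hη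
  rcases hη.1.eq_or_lt with rfl | hpos
  exacts [h0, h η ⟨hpos, hη.2⟩]

section ClosedForm

variable {a b c : E3} (hc : c ≠ 0)
include hc

lemma hFun_zero_left (hb : 0 < logArg b c) (η : ℝ) : hFun 0 b c η = 1 := by
  have hb0 : b ≠ 0 := by rintro rfl; rw [logArg_zero_left] at hb; exact hb.false
  have hL := (logArg_eq_zero_iff_norm_add hc b).not.1 hb.ne'
  rw [hFun_eq_div, smul_zero, zero_add, real_inner_self_eq_norm_sq]
  have := norm_ne_zero_iff.2 hb0
  field_simp

lemma hFun_of_qPar_eq_zero (ha : a ≠ 0) (hq : qPar a b = 0) {η : ℝ}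
    (hL : logArg (η • a + b) c ≠ 0) : hFun a b c η = pPar a b / (η + pPar a b) := by
  have hLhat := (logArg_eq_zero_iff_norm_add hc _).not.1 hL
  have hb := eq_pPar_smul_of_qPar_eq_zero ha hq
  have hx : η • a + b = (η + pPar a b) • a := by rw [add_smul, ← hb]
  have hx0 : η • a + b ≠ 0 := by intro h; rw [h, logArg_zero_left] at hL; exact hL rfl
  have hs : η + pPar a b ≠ 0 := by intro h; rw [hx, h, zero_smul] at hx0; exact hx0 rfl
  have hbx : b = (pPar a b / (η + pPar a b)) • (η • a + b) := by
    rw [hx, smul_smul, div_mul_cancel₀ _ hs, ← hb]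
  have hn := norm_ne_zero_iff.2 hx0
  rw [hFun_eq_div]
  generalize η • a + b = x at *
  generalize pPar a b / (η + pPar a b) = r at *
  rw [hbx, real_inner_smul_left, real_inner_smul_right, real_inner_self_eq_norm_sq]
  field_simp

lemma hIntegral_zero_left (h : Regular 0 b c) :
    IntervalIntegrable (hFun 0 b c) volume 0 1 ∧ hIntegral 0 b c = 1 := by
  have hb := (regular_iff hc).1 h 1 (right_mem_Ioc.2 zero_lt_one)
  rw [smul_zero, zero_add] at hb
  have := intervalIntegrable_and_integral_eq_sub_of_hasDerivAt (f := hFun 0 b c)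
    (Φ := id) (a := 0) (b := 1) continuousOn_const (fun η _ => hasDerivAt_id η)
    fun η _ => hFun_zero_left hc hb η
  rwa [id, id, sub_zero] at this

lemma hIntegral_of_qPar_eq_zero (ha : a ≠ 0) (hq : qPar a b = 0) (h : Regular a b c) :
    IntervalIntegrable (hFun a b c) volume 0 1 ∧
      hIntegral a b c = pPar a b * Real.log (1 + 1 / pPar a b) := by
  have hreg := (regular_iff hc).1 h
  have heq : EqOn (hFun a b c) (fun η => pPar a b / (η + pPar a b)) (uIoc 0 1) := fun η hη =>
    hFun_of_qPar_eq_zero hc ha hq (hreg η (uIoc_of_le (zero_le_one' ℝ) ▸ hη)).ne'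
  rw [hIntegral]
  by_cases hp : pPar a b = 0
  · simp only [hp, zero_div] at heq
    have := intervalIntegrable_and_integral_eq_sub_of_hasDerivAt continuousOn_const
      (fun η _ => hasDerivAt_const η (0 : ℝ)) heq
    rw [sub_zero] at this
    rwa [hp, zero_mul]
  have hne : ∀ η ∈ uIcc (0 : ℝ) 1, η + pPar a b ≠ 0 := by
    refine forall_mem_uIcc_zero_one (by rwa [zero_add]) fun η hη h0 => ?_
    have := hreg η hη
    rw [eq_pPar_smul_of_qPar_eq_zero ha hq, ← add_smul, h0, zero_smul, logArg_zero_left] at this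
    exact this.false
  have hderiv : ∀ η ∈ uIcc (0 : ℝ) 1,
      HasDerivAt (fun η => pPar a b * Real.log (η + pPar a b)) (pPar a b / (η + pPar a b)) η :=
    fun η hη => ((((hasDerivAt_id η).add_const _).log (hne η hη)).const_mul _).congr_deriv
      (mul_one_div _ _)
  have hone : 1 + 1 / pPar a b = (1 + pPar a b) / pPar a b := by field_simp; ring
  rw [hone, Real.log_div (hne 1 right_mem_uIcc) hp, mul_sub]
  nth_rw 4 [← zero_add (pPar a b)]
  exact intervalIntegrable_and_integral_eq_sub_of_hasDerivAt
    (continuousOn_const.div (by fun_prop) hne) hderiv heq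

lemma hIntegral_of_qPar_pos (ha : a ≠ 0) (hq : 0 < qPar a b) (h : Regular a b c) :
    IntervalIntegrable (hFun a b c) volume 0 1 ∧
      hIntegral a b c = 2 * qPar a b * (antiF a b c (tPar a b 1) + antiG a b c (tPar a b 1)) -
        2 * qPar a b * (antiF a b c (tPar a b 0) + antiG a b c (tPar a b 0)) := by
  have hreg := (regular_iff hc).1 h
  by_cases hb : logArg ((0 : ℝ) • a + b) c = 0
  · -- Regularity allows a zero of the denominator at `η = 0`; it is then cancelled by the numerator
    -- `γ₃ + γ₄ t`, which vanishes identically, so that `G` drops out.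
    have hγ4 : gamma4 a b c = 0 := by
      have := qPar_mul_gamma1_sub_gamma2 ha hq hc hb
      rw [neg_zero, mul_eq_zero, or_iff_right hq.ne'] at this
      rw [gamma4, this, mul_zero]
    have hγ3 : gamma3 a b c = 0 := by
      have := gamma3_add_gamma4_mul_tPar_eq_zero ha hq hc hb
      rwa [hγ4, zero_mul, add_zero] at this
    have hderiv (η : ℝ) := hasDerivAt_antiF_tPar hq ha c η
    have hcont := continuous_tPar hq
    simp only [antiG_eq_zero ⟨hγ3, hγ4⟩, add_zero]
    refine intervalIntegrable_and_integral_eq_sub_of_hasDerivAt (Continuous.continuousOn ?_)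
      (fun η _ => hderiv η) fun η hη => ?_
    · exact (continuous_const.div (by fun_prop) fun η => (norm_smul_add_pos ha hq η).ne').mul
        (by fun_prop)
    · rw [uIoc_of_le zero_le_one] at hη
      have := hasDerivAt_antiF_add_antiG hq ha hc (hreg η hη).ne'
      simp only [antiG_eq_zero ⟨hγ3, hγ4⟩, add_zero] at this
      exact this.unique (hderiv η)
  · have hL := forall_mem_uIcc_zero_one hb fun η hη => (hreg η hη).ne'
    refine intervalIntegrable_and_integral_eq_sub_of_hasDerivAt ?_
      (fun η hη => hasDerivAt_antiF_add_antiG hq ha hc (hL η hη)) (eqOn_refl _ _)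
    rw [funext (hFun_eq_div a b c)]
    exact ContinuousOn.div (by fun_prop) (by fun_prop) fun η hη =>
      mul_ne_zero (norm_smul_add_pos ha hq η).ne'
        ((logArg_eq_zero_iff_norm_add hc _).not.1 (hL η hη))

lemma hIntegral_of_regular (h : Regular a b c) :
    IntervalIntegrable (hFun a b c) volume 0 1 ∧ hIntegral a b c = hClosed a b c := by
  rw [hClosed]
  split_ifs with ha hq
  · rw [ha] at h ⊢
    exact hIntegral_zero_left hc h
  · exact hIntegral_of_qPar_eq_zero hc ha hq h
  · have hvalue := hIntegral_of_qPar_pos hc ha ((qPar_nonneg a b).lt_of_ne' hq) h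
    refine ⟨hvalue.1, hvalue.2.trans ?_⟩
    rw [tOne_eq, tZero_eq]
    ring

end ClosedForm

/-! ### The integral of the logarithm -/

lemma hasDerivAt_norm_smul_add {E : Type*} [NormedAddCommGroup E] [InnerProductSpace ℝ E]
    {a b : E} {η : ℝ} (hx : η • a + b ≠ 0) :
    HasDerivAt (fun η : ℝ => ‖η • a + b‖) (inner ℝ (η • a + b) a / ‖η • a + b‖) η := by
  have : ‖η • a + b‖ ≠ 0 := norm_ne_zero_iff.2 hx
  have affine : HasDerivAt (fun η : ℝ => η • a + b) a η :=
    (((hasDerivAt_id η).smul_const a).add_const b).congr_deriv (one_smul ℝ a)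
  have h := affine.norm_sq.sqrt (by positivity)
  simp only [Real.sqrt_sq (norm_nonneg _)] at h
  exact h.congr_deriv (mul_div_mul_left _ _ two_ne_zero)

lemma hasDerivAt_logArg {a b : E3} (c : E3) {η : ℝ} (hx : η • a + b ≠ 0) :
    HasDerivAt (fun η : ℝ => logArg (η • a + b) c)
      (inner ℝ (η • a + b) a / ‖η • a + b‖ * ‖c‖ + inner ℝ a c) η := by
  have h : HasDerivAt (fun η : ℝ => inner ℝ (η • a + b) c) (inner ℝ a c) η := by
    simp_rw [inner_add_left, real_inner_smul_left]
    exact (((hasDerivAt_id η).mul_const _).add_const _).congr_deriv (one_mul _)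
  exact ((hasDerivAt_norm_smul_add hx).mul_const ‖c‖).add h

lemma ne_zero_of_logArg_ne_zero {x c : E3} (hL : logArg x c ≠ 0) : x ≠ 0 := by
  rintro rfl; exact hL (logArg_zero_left c)

/-- Integration by parts of `log L`, where `L η = logArg (η • a + b) c`, produces `η L' / L`: this
identity is how `h` enters. -/
lemma mul_deriv_logArg {a b c : E3} (hc : c ≠ 0) {η : ℝ} (hL : logArg (η • a + b) c ≠ 0) :
    η * ((inner ℝ (η • a + b) a / ‖η • a + b‖ * ‖c‖ + inner ℝ a c) / logArg (η • a + b) c) =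
      1 - hFun a b c η := by
  have hx := norm_ne_zero_iff.2 (ne_zero_of_logArg_ne_zero hL)
  have hcn := norm_ne_zero_iff.2 hc
  have hLhat := (logArg_eq_zero_iff_norm_add hc _).not.1 hL
  have along_x : η * inner ℝ (η • a + b) a = ‖η • a + b‖ ^ 2 - inner ℝ (η • a + b) b := by
    rw [← real_inner_self_eq_norm_sq, ← inner_sub_right, add_sub_cancel_right,
      real_inner_smul_right]
  have along_c : η * inner ℝ a (hat c) = inner ℝ (η • a + b) (hat c) - inner ℝ b (hat c) := by
    rw [← inner_sub_left, add_sub_cancel_right, real_inner_smul_left]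
  rw [hFun_eq_div, logArg_eq hc, inner_eq_norm_mul_inner_hat hc]
  field_simp
  linear_combination along_x + ‖η • a + b‖ * along_c

lemma exists_log_logArg_le (a b c : E3) :
    ∃ C, ∀ η ∈ Icc (0 : ℝ) 1, Real.log (logArg (η • a + b) c) ≤ C := by
  obtain ⟨C, hC⟩ := (isCompact_Icc (a := (0 : ℝ)) (b := 1)).bddAbove_image
    (f := fun η => logArg (η • a + b) c) (by fun_prop)
  exact ⟨C, fun η hη => (Real.log_le_self (logArg_nonneg _ _)).trans
    (hC (mem_image_of_mem _ hη))⟩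

lemma intervalIntegrable_of_hasDerivAt_of_le {f Φ : ℝ → ℝ} {a b C : ℝ}
    (hΦ : ContinuousOn Φ (uIcc a b))
    (hderiv : ∀ η ∈ Ioo (min a b) (max a b), HasDerivAt Φ (f η) η)
    (hle : ∀ η ∈ Ioo (min a b) (max a b), f η ≤ C) : IntervalIntegrable f volume a b := by
  have h : IntervalIntegrable (fun η => C - f η) volume a b :=
    intervalIntegral.intervalIntegrable_deriv_of_nonneg (g := fun η => C * η - Φ η)
      (ContinuousOn.sub (by fun_prop) hΦ)
      (fun η hη => (((hasDerivAt_id η).const_mul C).sub (hderiv η hη)).congr_deriv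
        (by rw [mul_one]))
      fun η hη => sub_nonneg.2 (hle η hη)
  simpa only [sub_sub_cancel] using (intervalIntegrable_const (c := C)).sub h

lemma intervalIntegrable_and_integral_eq_sub_off_point {f Φ : ℝ → ℝ} {a b r C : ℝ}
    (hr : r ∈ Icc a b) (hΦ : ContinuousOn Φ (Icc a b))
    (hderiv : ∀ η ∈ Ioo a b, η ≠ r → HasDerivAt Φ (f η) η) (hle : ∀ η ∈ Icc a b, f η ≤ C) :
    IntervalIntegrable f volume a b ∧ ∫ η in a..b, f η = Φ b - Φ a := by
  have left : IntervalIntegrable f volume a r := by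
    apply intervalIntegrable_of_hasDerivAt_of_le (Φ := Φ) (C := C) <;>
      simp only [uIcc_of_le hr.1, min_eq_left hr.1, max_eq_right hr.1]
    · exact hΦ.mono (Icc_subset_Icc_right hr.2)
    · exact fun η hη => hderiv η ⟨hη.1, hη.2.trans_le hr.2⟩ hη.2.ne
    · exact fun η hη => hle η ⟨hη.1.le, hη.2.le.trans hr.2⟩
  have right : IntervalIntegrable f volume r b := by
    apply intervalIntegrable_of_hasDerivAt_of_le (Φ := Φ) (C := C) <;>
      simp only [uIcc_of_le hr.2, min_eq_left hr.2, max_eq_right hr.2]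
    · exact hΦ.mono (Icc_subset_Icc_left hr.1)
    · exact fun η hη => hderiv η ⟨hr.1.trans_lt hη.1, hη.2⟩ hη.1.ne'
    · exact fun η hη => hle η ⟨hr.1.trans hη.1.le, hη.2.le⟩
  exact ⟨left.trans right, integral_eq_of_hasDerivAt_off_countable_of_le Φ f (hr.1.trans hr.2)
    (countable_singleton r) hΦ (fun η hη => hderiv η hη.1 hη.2) (left.trans right)⟩

/-- The antiderivative of `log L`, `L η = logArg (η • a + b) c`, that integration by parts and the
antiderivative of `h` yield for `q > 0`. -/
noncomputable def logPrim (a b c : E3) (η : ℝ) : ℝ := η * Real.log (logArg (η • a + b) c) - η +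
  2 * qPar a b * (antiF a b c (tPar a b η) + antiG a b c (tPar a b η))

/-- The continuous function that agrees with `logPrim` away from a zero `r` of `L`. With
`t = tPar a b η` one has `L η = ‖c‖ α₂ (t - tᵣ)² / (1 - t²)` and `2 q G t = -2 r log |t - tᵣ|`, so
the singular terms of `logPrim` add up to `2 (η - r) log |t - tᵣ|`. -/
noncomputable def logPrimExt (a b c : E3) (r η : ℝ) : ℝ :=
  η * (Real.log ‖c‖ + Real.log (alpha2 a b c) - Real.log (1 - tPar a b η ^ 2)) - η +
    2 * qPar a b * antiF a b c (tPar a b η) +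
    2 * ((η - r) * Real.log (tPar a b η - tPar a b r))

lemma hasDerivAt_logPrim {a b c : E3} (ha : a ≠ 0) (hq : 0 < qPar a b) (hc : c ≠ 0) {η : ℝ}
    (hL : logArg (η • a + b) c ≠ 0) :
    HasDerivAt (logPrim a b c) (Real.log (logArg (η • a + b) c)) η := by
  refine ((((hasDerivAt_id η).mul
    ((hasDerivAt_logArg c (ne_zero_of_logArg_ne_zero hL)).log hL)).sub (hasDerivAt_id η)).add
    (hasDerivAt_antiF_add_antiG hq ha hc hL)).congr_deriv ?_
  rw [id, mul_deriv_logArg hc hL]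
  ring

lemma logPrim_one_sub_zero {a b : E3} (ha : a ≠ 0) (hq : 0 < qPar a b) (c : E3) :
    logPrim a b c 1 - logPrim a b c 0 = Real.log (logArg (a + b) c) - 1 + hClosed a b c := by
  rw [hClosed, if_neg ha, if_neg hq.ne', logPrim, logPrim, tOne_eq, tZero_eq, one_smul]
  ring

lemma sub_mul_eq_tPar_sub {a b : E3} (hq : 0 < qPar a b) (η r : ℝ) :
    (η - r) * ((1 - tPar a b η ^ 2) * (1 - tPar a b r ^ 2)) =
      2 * qPar a b * (1 + tPar a b η * tPar a b r) * (tPar a b η - tPar a b r) := by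
  have hη := two_mul_mul_tanHalf hq (η + pPar a b)
  have hr := two_mul_mul_tanHalf hq (r + pPar a b)
  rw [← tPar] at hη hr
  linear_combination (1 - tPar a b η ^ 2) * hr - (1 - tPar a b r ^ 2) * hη

lemma tPar_injective {a b : E3} (hq : 0 < qPar a b) : Function.Injective (tPar a b) := by
  intro η r h
  have hdiff := sub_mul_eq_tPar_sub hq η r
  rw [h, sub_self, mul_zero, mul_eq_zero, sub_eq_zero] at hdiff
  have := one_sub_sq_tPar_pos hq r
  exact hdiff.resolve_right (by positivity)

/-- The logarithmic singularity is cancelled by the simple zero of `η - r`. -/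
lemma continuous_sub_mul_log_tPar_sub {a b : E3} (hq : 0 < qPar a b) (r : ℝ) :
    Continuous fun η => (η - r) * Real.log (tPar a b η - tPar a b r) := by
  have hpos (η : ℝ) : (1 - tPar a b η ^ 2) * (1 - tPar a b r ^ 2) ≠ 0 :=
    (mul_pos (one_sub_sq_tPar_pos hq η) (one_sub_sq_tPar_pos hq r)).ne'
  have factored (η : ℝ) : (η - r) * Real.log (tPar a b η - tPar a b r) =
      2 * qPar a b * (1 + tPar a b η * tPar a b r) /
        ((1 - tPar a b η ^ 2) * (1 - tPar a b r ^ 2)) *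
        ((tPar a b η - tPar a b r) * Real.log (tPar a b η - tPar a b r)) := by
    rw [← mul_assoc, div_mul_eq_mul_div, ← sub_mul_eq_tPar_sub hq, mul_div_cancel_right₀ _ (hpos η)]
  have ht := continuous_tPar hq
  simp_rw [factored]
  exact (Continuous.div (by fun_prop) (by fun_prop) hpos).mul
    (Real.continuous_mul_log.comp (by fun_prop))

lemma continuous_logPrimExt {a b : E3} (hq : 0 < qPar a b) (c : E3) (r : ℝ) :
    Continuous (logPrimExt a b c r) := by
  have ht := continuous_tPar hq
  have hF : Continuous fun η => antiF a b c (tPar a b η) := continuous_iff_continuousAt.2 fun η =>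
    ContinuousAt.comp (f := tPar a b)
      (hasDerivAt_antiF a b c (neg_one_lt_tPar hq η) (tPar_lt_one hq η)).continuousAt
      ht.continuousAt
  have hlog : Continuous fun η => Real.log (1 - tPar a b η ^ 2) :=
    Continuous.log (by fun_prop) fun η => (one_sub_sq_tPar_pos hq η).ne'
  have hr := continuous_sub_mul_log_tPar_sub hq r
  unfold logPrimExt
  fun_prop

section LogRoot

variable {a b c : E3} (ha : a ≠ 0) (hq : 0 < qPar a b) (hc : c ≠ 0) {r : ℝ}
  (hr : logArg (r • a + b) c = 0)
include ha hq hc hr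

lemma two_mul_alpha2_mul_tPar_add : 2 * alpha2 a b c * tPar a b r + alpha1 a b c = 0 :=
  (disc_eq_zero_of_quadA_eq_zero ha hc (quadA_tPar_eq_zero ha hq hc hr)).2

lemma alpha2_pos_of_logArg_eq_zero : 0 < alpha2 a b c := by
  have hA := quadA_tPar_eq_zero ha hq hc hr
  have hD := (disc_eq_zero_of_quadA_eq_zero ha hc hA).1
  have hsum : alpha0 a b c + alpha2 a b c = 2 * qPar a b * ‖a‖ := by
    rw [alpha0_eq, alpha2_eq]; ring
  have : 0 ≤ qPar a b * ‖a‖ := by positivity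
  rw [disc] at hD
  refine lt_of_le_of_ne ?_ (alpha2_ne_zero_of_quadA_eq_zero ha hq hc hA).symm
  nlinarith [sq_nonneg (alpha1 a b c), sq_nonneg (alpha2 a b c)]

lemma eq_of_logArg_eq_zero {η : ℝ} (hη : logArg (η • a + b) c = 0) : η = r := by
  have hα := alpha2_pos_of_logArg_eq_zero ha hq hc hr
  have h1 := two_mul_alpha2_mul_tPar_add ha hq hc hr
  have h2 := two_mul_alpha2_mul_tPar_add ha hq hc hη
  exact tPar_injective hq (mul_left_cancel₀ (mul_pos two_pos hα).ne' (by linarith))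

lemma two_mul_qPar_mul_antiG (η : ℝ) : 2 * qPar a b * antiG a b c (tPar a b η) =
    -2 * r * Real.log (tPar a b η - tPar a b r) := by
  have hα := (alpha2_pos_of_logArg_eq_zero ha hq hc hr).ne'
  have hD := (disc_eq_zero_of_quadA_eq_zero ha hc (quadA_tPar_eq_zero ha hq hc hr)).1
  have hroot := two_mul_alpha2_mul_tPar_add ha hq hc hr
  have hγ := gamma3_add_gamma4_mul_tPar_eq_zero ha hq hc hr
  have hcoef := qPar_mul_gamma1_sub_gamma2 ha hq hc hr
  have centre : alpha1 a b c / (2 * alpha2 a b c) = -tPar a b r := by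
    field_simp; linarith
  rw [antiG]
  split_ifs with hzero hpos
  · have h4 : gamma4 a b c = 0 := (hzero.resolve_left hα).2
    rw [gamma4, mul_eq_zero, or_iff_right hα] at h4
    have hr0 : r = 0 := by rw [h4, mul_zero] at hcoef; linarith
    rw [hr0]; ring
  · exact absurd hD hpos.ne'
  · have pole : 2 * gamma3 a b c * alpha2 a b c - gamma4 a b c * alpha1 a b c = 0 := by
      linear_combination 2 * alpha2 a b c * hγ - gamma4 a b c * hroot
    rw [pole, centre, zero_div, sub_zero, gamma4, mul_div_cancel_left₀ _ hα, ← sub_eq_add_neg,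
      Real.log_abs]
    linear_combination 2 * Real.log (tPar a b η - tPar a b r) * hcoef

lemma quadA_eq_mul_sub_tPar_sq (t : ℝ) : quadA a b c t = alpha2 a b c * (t - tPar a b r) ^ 2 := by
  have hA := quadA_tPar_eq_zero ha hq hc hr
  have hroot := two_mul_alpha2_mul_tPar_add ha hq hc hr
  rw [quadA] at hA ⊢
  linear_combination hA + (t - tPar a b r) * hroot

lemma log_logArg_eq {η : ℝ} (hη : η ≠ r) : Real.log (logArg (η • a + b) c) =
    Real.log ‖c‖ + Real.log (alpha2 a b c) + 2 * Real.log (tPar a b η - tPar a b r) -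
      Real.log (1 - tPar a b η ^ 2) := by
  have hcn : 0 < ‖c‖ := norm_pos_iff.2 hc
  have hα := alpha2_pos_of_logArg_eq_zero ha hq hc hr
  have ht := one_sub_sq_tPar_pos hq η
  have htr : tPar a b η - tPar a b r ≠ 0 := sub_ne_zero.2 ((tPar_injective hq).ne hη)
  have hL : logArg (η • a + b) c =
      ‖c‖ * (alpha2 a b c * (tPar a b η - tPar a b r) ^ 2) / (1 - tPar a b η ^ 2) := by
    rw [← quadA_eq_mul_sub_tPar_sq ha hq hc hr, quadA_tPar hq ha, logArg_eq hc]
    field_simp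
  rw [hL, Real.log_div (by positivity) ht.ne', Real.log_mul hcn.ne' (by positivity),
    Real.log_mul hα.ne' (by positivity), Real.log_pow]
  push_cast
  ring

lemma logPrim_eq_logPrimExt {η : ℝ} (hη : η = r → r = 0) :
    logPrim a b c η = logPrimExt a b c r η := by
  rw [logPrim, logPrimExt, mul_add (2 * qPar a b), two_mul_qPar_mul_antiG ha hq hc hr]
  by_cases h : η = r
  · rw [h, hη h]; ring
  · rw [log_logArg_eq ha hq hc hr h]; ring

end LogRoot

lemma add_div_one_add_pos {p η : ℝ} (hp : ∀ η ∈ Icc (0 : ℝ) 1, η + p ≠ 0)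
    (hη : η ∈ Icc (0 : ℝ) 1) : 0 < (η + p) / (1 + p) := by
  rcases lt_or_ge 0 p with hpos | hneg
  · exact div_pos (by linarith [hη.1]) (by linarith)
  · have h1p : 1 + p < 0 := by
      by_contra! h
      exact hp (-p) ⟨by linarith, by linarith⟩ (neg_add_cancel p)
    exact div_pos_of_neg_of_neg (by linarith [hη.2]) h1p

section IntegralLog

variable {a b c : E3}

lemma add_pPar_ne_zero (ha : a ≠ 0) (hq : qPar a b = 0)
    (hx : ∀ η ∈ Icc (0 : ℝ) 1, η • a + b ≠ 0) : ∀ η ∈ Icc (0 : ℝ) 1, η + pPar a b ≠ 0 := by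
  intro η hη h
  refine hx η hη ?_
  rw [eq_pPar_smul_of_qPar_eq_zero ha hq, ← add_smul, h, zero_smul]

lemma logArg_smul_add_of_qPar_eq_zero (c : E3) (ha : a ≠ 0) (hq : qPar a b = 0)
    (hx : ∀ η ∈ Icc (0 : ℝ) 1, η • a + b ≠ 0) {η : ℝ} (hη : η ∈ Icc (0 : ℝ) 1) :
    logArg (η • a + b) c = (η + pPar a b) / (1 + pPar a b) * logArg (a + b) c := by
  have hs := add_pPar_ne_zero ha hq hx
  have hb := eq_pPar_smul_of_qPar_eq_zero ha hq
  have hpos := add_div_one_add_pos hs hη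
  have collinear : η • a + b = ((η + pPar a b) / (1 + pPar a b)) • (a + b) := by
    have hone : a + b = (1 + pPar a b) • a := by rw [add_smul, one_smul, ← hb]
    rw [hone, smul_smul, div_mul_cancel₀ _ (hs 1 (right_mem_Icc.2 zero_le_one)), add_smul, ← hb]
  rw [collinear, logArg, logArg, norm_smul, real_inner_smul_left, Real.norm_of_nonneg hpos.le]
  ring

lemma integral_log_logArg_of_qPar_eq_zero (ha : a ≠ 0) (hq : qPar a b = 0)
    (hx : ∀ η ∈ Icc (0 : ℝ) 1, η • a + b ≠ 0) (h1 : 0 < logArg (a + b) c) :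
    IntervalIntegrable (fun η : ℝ => Real.log (logArg (η • a + b) c)) volume 0 1 ∧
      ∫ η in (0 : ℝ)..1, Real.log (logArg (η • a + b) c) =
        Real.log (logArg (a + b) c) - 1 + hClosed a b c := by
  have hs := add_pPar_ne_zero ha hq hx
  have hL := fun η hη => logArg_smul_add_of_qPar_eq_zero c ha hq hx (η := η) hη
  rw [hClosed, if_neg ha, if_pos hq]
  generalize pPar a b = p at *
  set C := Real.log (logArg (a + b) c) - Real.log (1 + p) with hC
  have h1p := hs 1 (right_mem_Icc.2 zero_le_one)
  have h0p : p ≠ 0 := by simpa only [zero_add] using hs 0 (left_mem_Icc.2 zero_le_one)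
  rw [← uIcc_of_le (zero_le_one' ℝ)] at hs hL
  have hone : 1 + 1 / p = (1 + p) / p := by field_simp; ring
  have hlog : EqOn (fun η : ℝ => Real.log (logArg (η • a + b) c))
      (fun η => Real.log (η + p) + C) (uIcc 0 1) := by
    intro η hη
    simp only [hL η hη]
    rw [Real.log_mul (div_ne_zero (hs η hη) h1p) h1.ne', Real.log_div (hs η hη) h1p]
    ring
  have hderiv : ∀ η ∈ uIcc (0 : ℝ) 1, HasDerivAt
      (fun η => (η + p) * Real.log (η + p) - η + η * C) (Real.log (η + p) + C) η := by
    intro η hη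
    have := hs η hη
    have hlin := (hasDerivAt_id η).add_const p
    refine (((hlin.mul (hlin.log (hs η hη))).sub (hasDerivAt_id η)).add
      ((hasDerivAt_id η).mul_const C)).congr_deriv ?_
    simp only [id]
    field_simp
    ring
  have h := intervalIntegrable_and_integral_eq_sub_of_hasDerivAt
    ((ContinuousOn.log (by fun_prop) hs).add continuousOn_const) hderiv
    (hlog.mono uIoc_subset_uIcc)
  refine ⟨h.1, h.2.trans ?_⟩
  rw [hone, Real.log_div h1p h0p, hC, zero_add]
  ring

lemma integral_log_logArg_of_qPar_pos (hc : c ≠ 0) (ha : a ≠ 0) (hq : 0 < qPar a b)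
    (h1 : 0 < logArg (a + b) c) :
    IntervalIntegrable (fun η : ℝ => Real.log (logArg (η • a + b) c)) volume 0 1 ∧
      ∫ η in (0 : ℝ)..1, Real.log (logArg (η • a + b) c) =
        Real.log (logArg (a + b) c) - 1 + hClosed a b c := by
  rw [← logPrim_one_sub_zero ha hq]
  by_cases hroot : ∃ r ∈ Icc (0 : ℝ) 1, logArg (r • a + b) c = 0
  · obtain ⟨r, hrmem, hr⟩ := hroot
    obtain ⟨C, hC⟩ := exists_log_logArg_le a b c
    have hone : (1 : ℝ) ≠ r := by rintro rfl; rw [one_smul] at hr; exact h1.ne' hr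
    rw [logPrim_eq_logPrimExt ha hq hc hr Eq.symm,
      logPrim_eq_logPrimExt ha hq hc hr fun h => absurd h hone]
    refine intervalIntegrable_and_integral_eq_sub_off_point hrmem
      (continuous_logPrimExt hq c r).continuousOn (fun η _ hη => ?_) hC
    have hL : logArg (η • a + b) c ≠ 0 := fun h => hη (eq_of_logArg_eq_zero ha hq hc hr h)
    refine (hasDerivAt_logPrim ha hq hc hL).congr_of_eventuallyEq ?_
    filter_upwards [isOpen_ne.mem_nhds hη] with y hy
    exact (logPrim_eq_logPrimExt ha hq hc hr fun h => absurd h hy).symm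
  · push Not at hroot
    rw [← uIcc_of_le (zero_le_one' ℝ)] at hroot
    exact intervalIntegrable_and_integral_eq_sub_of_hasDerivAt
      (ContinuousOn.log (by fun_prop) hroot)
      (fun η hη => hasDerivAt_logPrim ha hq hc (hroot η hη)) (eqOn_refl _ _)

lemma integral_log_logArg (hc : c ≠ 0) (hx : ∀ η ∈ Icc (0 : ℝ) 1, η • a + b ≠ 0)
    (h1 : 0 < logArg (a + b) c) :
    IntervalIntegrable (fun η : ℝ => Real.log (logArg (η • a + b) c)) volume 0 1 ∧
      ∫ η in (0 : ℝ)..1, Real.log (logArg (η • a + b) c) =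
        Real.log (logArg (a + b) c) - 1 + hClosed a b c := by
  by_cases ha : a = 0
  · simp only [ha, smul_zero, hClosed, if_true, zero_add, intervalIntegrable_const,
      intervalIntegral.integral_const, sub_zero, one_smul, sub_add_cancel, and_self]
  rcases (qPar_nonneg a b).eq_or_lt with hq | hq
  · exact integral_log_logArg_of_qPar_eq_zero ha hq.symm hx h1
  · exact integral_log_logArg_of_qPar_pos hc ha hq h1

lemma subsingleton_setOf_logArg_eq_zero (hc : c ≠ 0)
    (hx : ∀ η ∈ Icc (0 : ℝ) 1, η • a + b ≠ 0) (h1 : 0 < logArg (a + b) c) :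
    {η ∈ Icc (0 : ℝ) 1 | logArg (η • a + b) c = 0}.Subsingleton := by
  rintro η ⟨hη, hη0⟩ r ⟨-, hr0⟩
  by_cases ha : a = 0
  · rw [ha, smul_zero] at hη0
    rw [ha] at h1
    exact absurd hη0 h1.ne'
  rcases (qPar_nonneg a b).eq_or_lt with hq | hq
  · rw [logArg_smul_add_of_qPar_eq_zero c ha hq.symm hx hη] at hη0
    have := add_div_one_add_pos (add_pPar_ne_zero ha hq.symm hx) hη
    exact absurd hη0 (by positivity)
  · exact eq_of_logArg_eq_zero ha hq hc hr0 hη0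

end IntegralLog

/-! ### Reduction of the integrals over the square to integrals of logarithms -/

lemma logArg_smul_add_pos {y c : E3} (hc : c ≠ 0) (hy : 0 < logArg y c) {s : ℝ} (hs : 0 ≤ s) :
    0 < logArg (s • c + y) c := by
  rw [logArg_pos_iff hc] at hy ⊢
  intro l hl h
  refine hy (l + s) (by positivity) ?_
  rw [add_smul, neg_add, ← h]
  abel

lemma hasDerivAt_log_logArg_smul_add {y c : E3} (hc : c ≠ 0) {S s : ℝ}
    (hL : 0 < logArg ((s * S) • c + y) c) :
    HasDerivAt (fun s : ℝ => 1 / ‖c‖ * Real.log (logArg ((s * S) • c + y) c))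
      (S / ‖(s * S) • c + y‖) s := by
  simp_rw [mul_smul] at hL ⊢
  have hx := ne_zero_of_logArg_ne_zero hL.ne'
  refine (((hasDerivAt_logArg c hx).log hL.ne').const_mul (1 / ‖c‖)).congr_deriv ?_
  have hcn := norm_ne_zero_iff.2 hc
  have hxn := norm_ne_zero_iff.2 hx
  have numerator : inner ℝ (s • S • c + y) (S • c) / ‖s • S • c + y‖ * ‖c‖ + inner ℝ (S • c) c =
      S * ‖c‖ * logArg (s • S • c + y) c / ‖s • S • c + y‖ := by
    rw [logArg, real_inner_smul_right, real_inner_smul_left, real_inner_self_eq_norm_sq]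
    field_simp
    ring
  rw [numerator]
  field_simp

lemma integral_div_norm_smul_add {y c : E3} (hc : c ≠ 0) (hy : 0 < logArg y c) {S : ℝ}
    (hS : 0 ≤ S) : ∫ s in (0 : ℝ)..1, S / ‖(s * S) • c + y‖ =
      1 / ‖c‖ * (Real.log (logArg (S • c + y) c) - Real.log (logArg y c)) := by
  have hpos : ∀ s ∈ uIcc (0 : ℝ) 1, 0 < logArg ((s * S) • c + y) c := by
    intro s hs
    rw [uIcc_of_le zero_le_one] at hs
    exact logArg_smul_add_pos hc hy (mul_nonneg hs.1 hS)
  have hcont : ContinuousOn (fun s : ℝ => S / ‖(s * S) • c + y‖) (uIcc 0 1) :=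
    ContinuousOn.div (by fun_prop) (by fun_prop) fun s hs =>
      norm_ne_zero_iff.2 (ne_zero_of_logArg_ne_zero (hpos s hs).ne')
  rw [intervalIntegral.integral_eq_sub_of_hasDerivAt
    (fun s hs => hasDerivAt_log_logArg_smul_add hc (hpos s hs)) hcont.intervalIntegrable,
    one_mul, zero_mul, zero_smul, zero_add, mul_sub]

lemma setIntegral_unitSquare_eq {a b a' b' c : E3} (hc : c ≠ 0) {f : ℝ × ℝ → ℝ} {S : ℝ → ℝ}
    (hf : IntegrableOn f unitSquare)
    (hfS : ∀ η s, f (η, s) = S η / ‖(s * S η) • c + (η • a' + b')‖)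
    (hS : ∀ η ∈ Ioo (0 : ℝ) 1, 0 ≤ S η) (hab : ∀ η : ℝ, S η • c + (η • a' + b') = η • a + b)
    (hx : ∀ η ∈ Icc (0 : ℝ) 1, η • a + b ≠ 0) (hx' : ∀ η ∈ Icc (0 : ℝ) 1, η • a' + b' ≠ 0)
    (h1 : 0 < logArg (a + b) c) (h1' : 0 < logArg (a' + b') c) :
    ∫ z in unitSquare, f z = 1 / ‖c‖ * Real.log (logArg (a + b) c / logArg (a' + b') c) -
      1 / ‖c‖ * (hClosed a' b' c - hClosed a b c) := by
  obtain ⟨hint, hval⟩ := integral_log_logArg hc hx h1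
  obtain ⟨hint', hval'⟩ := integral_log_logArg hc hx' h1'
  have hzero := (subsingleton_setOf_logArg_eq_zero hc hx' h1').measure_zero volume
  have inner_integral : ∀ᵐ η ∂(volume.restrict (Ioo (0 : ℝ) 1)), ∫ s in Ioo (0 : ℝ) 1, f (η, s) =
      1 / ‖c‖ * (Real.log (logArg (η • a + b) c) - Real.log (logArg (η • a' + b') c)) := by
    rw [ae_restrict_iff' measurableSet_Ioo]
    filter_upwards [measure_eq_zero_iff_ae_notMem.1 hzero] with η hη hη01
    have hpos : 0 < logArg (η • a' + b') c :=
      (logArg_nonneg _ _).lt_of_ne' fun h => hη ⟨Ioo_subset_Icc_self hη01, h⟩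
    simp_rw [hfS]
    rw [← hab, ← integral_div_norm_smul_add hc hpos (hS η hη01),
      intervalIntegral.integral_of_le zero_le_one, integral_Ioc_eq_integral_Ioo]
  calc ∫ z in unitSquare, f z
      = ∫ η in Ioo (0 : ℝ) 1, ∫ s in Ioo (0 : ℝ) 1, f (η, s) := setIntegral_prod f hf
    _ = ∫ η in (0 : ℝ)..1, 1 / ‖c‖ *
          (Real.log (logArg (η • a + b) c) - Real.log (logArg (η • a' + b') c)) := by
        rw [integral_congr_ae inner_integral, intervalIntegral.integral_of_le zero_le_one,
          integral_Ioc_eq_integral_Ioo]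
    _ = _ := by
        rw [intervalIntegral.integral_const_mul, intervalIntegral.integral_sub hint hint', hval,
          hval', Real.log_div h1.ne' h1'.ne']
        ring

/-! ### The edge condition and the table of vectors -/

/-- A relation between the edge vectors `v`, `u`, `-w` with nonnegative coefficients at `u` and `-w`
is trivial. This is the form in which the assumption that the triangles meet only in the common
edge is used. -/
def EdgeCone (u v w : E3) : Prop :=
  ∀ z Y X : ℝ, 0 ≤ Y → 0 ≤ X → z • v + Y • u - X • w = 0 → z = 0 ∧ Y = 0 ∧ X = 0

lemma gramRoot_eq (e f : E3) : gramRoot e f = √(‖e‖ ^ 2 * ‖f‖ ^ 2 - inner ℝ e f ^ 2) := by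
  rw [gramRoot, Matrix.det_fin_two]
  simp only [Matrix.mul_apply, Matrix.transpose_apply, jacobian, Matrix.of_apply,
    Fin.sum_univ_three, EuclideanSpace.norm_sq_eq, PiLp.inner_apply, Real.norm_eq_abs, sq_abs,
    RCLike.inner_apply, RCLike.conj_to_real, Matrix.cons_val_zero, Matrix.cons_val_one]
  ring_nf

lemma eq_zero_of_gramRoot_ne_zero {e f : E3} (h : gramRoot e f ≠ 0) {x y : ℝ}
    (hxy : x • e + y • f = 0) : x = 0 ∧ y = 0 := by
  rw [gramRoot_eq] at h
  have hG : ‖e‖ ^ 2 * ‖f‖ ^ 2 - inner ℝ e f ^ 2 ≠ 0 := by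
    intro h0; rw [h0, Real.sqrt_zero] at h; exact h rfl
  have he : x * ‖e‖ ^ 2 + y * inner ℝ e f = 0 := by
    rw [← real_inner_self_eq_norm_sq, ← real_inner_smul_right, ← real_inner_smul_right,
      ← inner_add_right, hxy, inner_zero_right]
  have hf : x * inner ℝ e f + y * ‖f‖ ^ 2 = 0 := by
    rw [← real_inner_self_eq_norm_sq, ← real_inner_smul_left, ← real_inner_smul_left,
      ← inner_add_left, hxy, inner_zero_left]
  constructor <;> refine (mul_eq_zero.1 ?_).resolve_right hG
  · linear_combination ‖f‖ ^ 2 * he - inner ℝ e f * hf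
  · linear_combination ‖e‖ ^ 2 * hf - inner ℝ e f * he

lemma mem_closedTriangle (p e f : E3) {x y : ℝ} (hy : 0 ≤ y) (hyx : y ≤ x) (hx : x ≤ 1) :
    p + x • e + y • f ∈ closedTriangle p e f := by
  have barycentric : p + x • e + y • f =
      ∑ i, ![1 - x, x - y, y] i • ![p, p + e, p + e + f] i := by
    rw [Fin.sum_univ_three]
    change _ = (1 - x) • p + (x - y) • (p + e) + y • (p + e + f)
    module
  rw [barycentric]
  refine (convex_convexHull ℝ _).sum_mem (fun i _ => ?_) ?_ fun i _ => subset_convexHull ℝ _ ?_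
  · match i with
    | 0 => exact sub_nonneg.2 hx
    | 1 => exact sub_nonneg.2 hyx
    | 2 => exact hy
  · rw [Fin.sum_univ_three]
    change 1 - x + (x - y) + y = 1
    ring
  · match i with
    | 0 => exact Or.inl rfl
    | 1 => exact Or.inr (Or.inl rfl)
    | 2 => exact Or.inr (Or.inr rfl)

/-- A relation is scaled so that it describes a common point of the triangles near the midpoint of
the edge. -/
lemma edgeCone_of_inter {p u v w : E3} (hu : gramRoot v u ≠ 0) (hw : gramRoot v w ≠ 0)
    (h : closedTriangle p v u ∩ closedTriangle p v w = segment ℝ p (p + v)) :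
    EdgeCone u v w := by
  intro z Y X hY hX h0
  obtain ⟨ε, hε, hsmall⟩ : ∃ ε > 0, ε * (|z| + Y + X) ≤ 1 / 4 := by
    refine ⟨1 / (4 * (1 + |z| + Y + X)), by positivity, ?_⟩
    rw [one_div_mul_eq_div, div_le_div_iff₀ (by positivity) (by norm_num)]
    linarith
  rw [mul_add, mul_add, ← abs_of_pos hε, ← abs_mul, abs_of_pos hε] at hsmall
  have hεY : 0 ≤ ε * Y := by positivity
  have hεX : 0 ≤ ε * X := by positivity
  have hz := abs_le.1 (show |ε * z| ≤ 1 / 4 - ε * Y by linarith)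
  have mem_u := mem_closedTriangle p v u (x := 1 / 2 + ε * z) (y := ε * Y) hεY
    (by linarith) (by linarith)
  have mem_w := mem_closedTriangle p v w (x := 1 / 2) (y := ε * X) hεX
    (by linarith [abs_nonneg (ε * z)]) (by norm_num)
  have common : p + (1 / 2 + ε * z) • v + (ε * Y) • u = p + (1 / 2 : ℝ) • v + (ε * X) • w := by
    linear_combination (norm := module) ε • h0
  rw [common] at mem_u
  have mem_edge : p + (1 / 2 : ℝ) • v + (ε * X) • w ∈ segment ℝ p (p + v) := h ▸ ⟨mem_u, mem_w⟩
  rw [segment_eq_image', add_sub_cancel_left] at mem_edge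
  obtain ⟨s, -, hs⟩ := mem_edge
  have hX0 : ε * X = 0 := (eq_zero_of_gramRoot_ne_zero hw (x := 1 / 2 - s)
    (by linear_combination (norm := module) -hs)).2
  rw [mul_eq_zero, or_iff_right hε.ne'] at hX0
  rw [hX0, zero_smul, sub_zero] at h0
  obtain ⟨hz0, hY0⟩ := eq_zero_of_gramRoot_ne_zero hu h0
  exact ⟨hz0, hY0, hX0⟩

lemma parA_add_parB_sub_parC (u v w : E3) (j : Fin 5) :
    parA u v w j + parB u v w j - parC u v w j = parA' u v w j + parB' u v w j := by
  rw [parA', parB']; split_ifs <;> abel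

lemma edgeIntegrand_zero (u v w : E3) (η s : ℝ) : edgeIntegrand u v w 0 (s, η) =
    1 / ‖(s * 1) • parC u v w 0 + (η • parA' u v w 0 + parB' u v w 0)‖ :=
  congrArg (fun x : E3 => 1 / ‖x‖) (show s • (u + v) + η • w - u =
    (s * 1) • (u + v) + (η • w + (v - (u + v))) by module)

lemma edgeIntegrand_of_ne_zero (u v w : E3) {j : Fin 5} (hj : j ≠ 0) (η s : ℝ) :
    edgeIntegrand u v w j (η, s) =
      η / ‖(s * η) • parC u v w j + (η • parA' u v w j + parB' u v w j)‖ :=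
  match j with
  | 0 => absurd rfl hj
  | 1 => congrArg (fun x : E3 => η / ‖x‖) (show (s * η) • (u + v) - η • u + w =
      (s * η) • (u + v) + (η • (v - (u + v)) + w) by module)
  | 2 => congrArg (fun x : E3 => η / ‖x‖) (show (s * η) • (w + v) - η • w + u =
      (s * η) • (w + v) + (η • (v - (w + v)) + u) by module)
  | 3 => congrArg (fun x : E3 => η / ‖x‖) (show (s * η) • u + η • (w + v) - w =
      (s * η) • u + (η • (u + v + w - u) + -w) by module)
  | 4 => congrArg (fun x : E3 => η / ‖x‖) (show (s * η) • (w + v) + η • u - w =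
      (s * η) • (v + w) + (η • (u + v + w - (v + w)) + -w) by module)

lemma integrableOn_unitSquare_div_norm {f : ℝ × ℝ → ℝ} {g : ℝ × ℝ → E3} (hf : Continuous f)
    (hg : Continuous g) (h0 : ∀ x ∈ Icc (0 : ℝ) 1, ∀ y ∈ Icc (0 : ℝ) 1, g (x, y) ≠ 0) :
    IntegrableOn (fun z => f z / ‖g z‖) unitSquare := by
  have hcont : ContinuousOn (fun z => f z / ‖g z‖) (Icc (0 : ℝ) 1 ×ˢ Icc (0 : ℝ) 1) :=
    hf.continuousOn.div hg.norm.continuousOn fun z hz => norm_ne_zero_iff.2 (h0 _ hz.1 _ hz.2)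
  exact (hcont.integrableOn_compact (isCompact_Icc.prod isCompact_Icc)).mono_set
    (prod_mono Ioo_subset_Icc_self Ioo_subset_Icc_self)

namespace EdgeCone

variable {u v w : E3} (h : EdgeCone u v w)
include h

lemma smul_add_ne_zero (j : Fin 5) {η : ℝ} (hη : η ∈ Icc (0 : ℝ) 1) :
    η • parA u v w j + parB u v w j ≠ 0 := by
  have hη' := sub_nonneg.2 hη.2
  match j with
  | 0 =>
    intro (h0 : η • w + v = 0)
    linarith [(h (-1) 0 η le_rfl hη.1 (by linear_combination (norm := module) -h0)).1]
  | 1 =>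
    intro (h0 : η • v + w = 0)
    linarith [(h (-η) 0 1 le_rfl zero_le_one (by linear_combination (norm := module) -h0)).2.2]
  | 2 =>
    intro (h0 : η • v + u = 0)
    linarith [(h η 1 0 zero_le_one le_rfl (by linear_combination (norm := module) h0)).2.1]
  | 3 | 4 =>
    intro (h0 : η • (u + v + w) + -w = 0)
    obtain ⟨hzero, -, hone⟩ := h η η (1 - η) hη.1 hη'
      (by linear_combination (norm := module) h0)
    linarith

lemma smul_add_ne_zero' (j : Fin 5) {η : ℝ} (hη : η ∈ Icc (0 : ℝ) 1) :
    η • parA' u v w j + parB' u v w j ≠ 0 := by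
  have hη' := sub_nonneg.2 hη.2
  match j with
  | 0 =>
    intro (h0 : η • w + (v - (u + v)) = 0)
    linarith [(h 0 1 η zero_le_one hη.1 (by linear_combination (norm := module) -h0)).2.1]
  | 1 =>
    intro (h0 : η • (v - (u + v)) + w = 0)
    linarith [(h 0 η 1 hη.1 zero_le_one (by linear_combination (norm := module) -h0)).2.2]
  | 2 =>
    intro (h0 : η • (v - (w + v)) + u = 0)
    linarith [(h 0 1 η zero_le_one hη.1 (by linear_combination (norm := module) h0)).2.1]
  | 3 =>
    intro (h0 : η • (u + v + w - u) + -w = 0)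
    obtain ⟨hzero, -, hone⟩ := h η 0 (1 - η) le_rfl hη'
      (by linear_combination (norm := module) h0)
    linarith
  | 4 =>
    intro (h0 : η • (u + v + w - (v + w)) + -w = 0)
    linarith [(h 0 η 1 hη.1 zero_le_one (by linear_combination (norm := module) h0)).2.2]

lemma parC_ne_zero (j : Fin 5) : parC u v w j ≠ 0 := by
  match j with
  | 0 | 1 =>
    intro (h0 : u + v = 0)
    linarith [(h 1 1 0 zero_le_one le_rfl (by linear_combination (norm := module) h0)).1]
  | 2 =>
    intro (h0 : w + v = 0)
    linarith [(h (-1) 0 1 le_rfl zero_le_one (by linear_combination (norm := module) -h0)).1]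
  | 3 =>
    intro (h0 : u = 0)
    linarith [(h 0 1 0 zero_le_one le_rfl (by linear_combination (norm := module) h0)).2.1]
  | 4 =>
    intro (h0 : v + w = 0)
    linarith [(h (-1) 0 1 le_rfl zero_le_one (by linear_combination (norm := module) -h0)).1]

lemma integrableOn_edgeIntegrand (j : Fin 5) :
    IntegrableOn (edgeIntegrand u v w j) unitSquare := by
  match j with
  | 0 =>
    refine integrableOn_unitSquare_div_norm (f := fun _ => 1)
      (g := fun z => z.1 • (u + v) + z.2 • w - u) (by fun_prop) (by fun_prop)
      fun x hx y hy (h0 : x • (u + v) + y • w - u = 0) => ?_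
    obtain ⟨hzero, hone, -⟩ := h (-x) (1 - x) y (sub_nonneg.2 hx.2) hy.1
      (by linear_combination (norm := module) -h0)
    linarith
  | 1 =>
    refine integrableOn_unitSquare_div_norm
      (g := fun z => (z.2 * z.1) • (u + v) - z.1 • u + w) (by fun_prop) (by fun_prop)
      fun x hx y hy (h0 : (y * x) • (u + v) - x • u + w = 0) => ?_
    linarith [(h (-(y * x)) (x * (1 - y)) 1 (mul_nonneg hx.1 (sub_nonneg.2 hy.2)) zero_le_one
      (by linear_combination (norm := module) -h0)).2.2]
  | 2 =>
    refine integrableOn_unitSquare_div_norm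
      (g := fun z => (z.2 * z.1) • (w + v) - z.1 • w + u) (by fun_prop) (by fun_prop)
      fun x hx y hy (h0 : (y * x) • (w + v) - x • w + u = 0) => ?_
    linarith [(h (y * x) 1 (x * (1 - y)) zero_le_one (mul_nonneg hx.1 (sub_nonneg.2 hy.2))
      (by linear_combination (norm := module) h0)).2.1]
  | 3 =>
    refine integrableOn_unitSquare_div_norm
      (g := fun z => (z.2 * z.1) • u + z.1 • (w + v) - w) (by fun_prop) (by fun_prop)
      fun x hx y hy (h0 : (y * x) • u + x • (w + v) - w = 0) => ?_
    obtain ⟨hzero, -, hone⟩ := h x (y * x) (1 - x) (mul_nonneg hy.1 hx.1) (sub_nonneg.2 hx.2)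
      (by linear_combination (norm := module) h0)
    linarith
  | 4 =>
    refine integrableOn_unitSquare_div_norm
      (g := fun z => (z.2 * z.1) • (w + v) + z.1 • u - w) (by fun_prop) (by fun_prop)
      fun x hx y hy (h0 : (y * x) • (w + v) + x • u - w = 0) => ?_
    obtain ⟨hzero, -, hone⟩ := h (y * x) x (1 - y * x) hx.1
      (sub_nonneg.2 (mul_le_one₀ hy.2 hx.1 hx.2)) (by linear_combination (norm := module) h0)
    linarith

lemma edgeIntegral_eq {j : Fin 5} (hj : LogDefined u v w j) :
    edgeIntegral u v w j = edgeFormula hClosed u v w j := by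
  have hc := h.parC_ne_zero j
  have hint := h.integrableOn_edgeIntegrand j
  have hsum := parA_add_parB_sub_parC u v w j
  obtain ⟨h1, h1'⟩ := hj
  rw [hsum] at h1'
  rw [edgeFormula, hsum, edgeIntegral]
  by_cases hj0 : j = 0
  · subst hj0
    have swapped : ∫ z in unitSquare, edgeIntegrand u v w 0 z =
        ∫ z in unitSquare, edgeIntegrand u v w 0 z.swap :=
      (setIntegral_prod_swap (μ := volume) (ν := volume) (Ioo (0 : ℝ) 1) (Ioo (0 : ℝ) 1)
        (edgeIntegrand u v w 0)).symm
    rw [swapped]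
    refine setIntegral_unitSquare_eq hc (S := fun _ => 1) (IntegrableOn.swap hint)
      (fun η s => edgeIntegrand_zero u v w η s) (fun _ _ => zero_le_one) (fun η => ?_)
      (fun _ => h.smul_add_ne_zero 0) (fun _ => h.smul_add_ne_zero' 0) h1 h1'
    rw [parA', parB', if_pos rfl, if_pos rfl]
    module
  · refine setIntegral_unitSquare_eq hc (S := fun η => η) hint
      (edgeIntegrand_of_ne_zero u v w hj0) (fun _ hη => hη.1.le) (fun η => ?_)
      (fun _ => h.smul_add_ne_zero j) (fun _ => h.smul_add_ne_zero' j) h1 h1'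
    rw [parA', parB', if_neg hj0, if_neg hj0]
    module

/-- If the coefficients have the same sign, the relation exhibits `p` as a point of the segment; if
they have opposite signs, it contradicts the edge condition. -/
lemma relation_ne_zero {p : E3} (hp : p ∉ segment ℝ (p + v + u) (p + v + w)) {β γ : ℝ}
    (hβγ : β ≠ 0 ∨ γ ≠ 0) : (β + γ) • v + β • u + γ • w ≠ 0 := by
  wlog hβ : 0 ≤ β generalizing β γ
  · intro h0
    refine this (hβγ.imp neg_ne_zero.2 neg_ne_zero.2) (by linarith) ?_
    linear_combination (norm := module) -h0
  intro h0
  rcases le_or_gt 0 γ with hγ | hγ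
  · have hpos : 0 < β + γ := by
      rcases hβγ with hne | hne
      · have := hβ.lt_of_ne' hne; positivity
      · have := hγ.lt_of_ne' hne; positivity
    have hdiv : β / (β + γ) + γ / (β + γ) = 1 := by rw [← add_div, div_self hpos.ne']
    refine hp ⟨β / (β + γ), γ / (β + γ), by positivity, by positivity, hdiv, ?_⟩
    linear_combination (norm := module) (1 / (β + γ)) • h0 + hdiv • p
  · obtain ⟨-, hβ0, hγ0⟩ := h (β + γ) β (-γ) hβ (by linarith)
      (by linear_combination (norm := module) h0)
    exact hβγ.elim (absurd hβ0) (absurd (neg_eq_zero.1 hγ0))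

lemma logArg_add_pos {p : E3} (hp : p ∉ segment ℝ (p + v + u) (p + v + w)) (j : Fin 5) :
    0 < logArg (parA u v w j + parB u v w j) (parC u v w j) := by
  have hrel := fun β γ => h.relation_ne_zero hp (β := β) (γ := γ)
  rw [logArg_pos_iff (h.parC_ne_zero j)]
  intro l hl
  match j with
  | 0 =>
    intro (h0 : w + v = -(l • (u + v)))
    exact hrel l 1 (Or.inr one_ne_zero) (by linear_combination (norm := module) h0)
  | 1 =>
    intro (h0 : v + w = -(l • (u + v)))
    exact hrel l 1 (Or.inr one_ne_zero) (by linear_combination (norm := module) h0)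
  | 2 =>
    intro (h0 : v + u = -(l • (w + v)))
    exact hrel 1 l (Or.inl one_ne_zero) (by linear_combination (norm := module) h0)
  | 3 =>
    intro (h0 : u + v + w + -w = -(l • u))
    linarith [(h 1 (1 + l) 0 (by positivity) le_rfl
      (by linear_combination (norm := module) h0)).1]
  | 4 =>
    intro (h0 : u + v + w + -w = -(l • (v + w)))
    exact hrel 1 l (Or.inl one_ne_zero) (by linear_combination (norm := module) h0)

lemma logArg_add_pos' {p : E3} (hp : p ∉ segment ℝ (p + v + u) (p + v + w)) (j : Fin 5) :
    0 < logArg (parA' u v w j + parB' u v w j) (parC u v w j) := by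
  have hrel := fun β γ => h.relation_ne_zero hp (β := β) (γ := γ)
  rw [logArg_pos_iff (h.parC_ne_zero j)]
  intro l hl
  match j with
  | 0 =>
    intro (h0 : w + (v - (u + v)) = -(l • (u + v)))
    exact hrel (l - 1) 1 (Or.inr one_ne_zero) (by linear_combination (norm := module) h0)
  | 1 =>
    intro (h0 : v - (u + v) + w = -(l • (u + v)))
    exact hrel (l - 1) 1 (Or.inr one_ne_zero) (by linear_combination (norm := module) h0)
  | 2 =>
    intro (h0 : v - (w + v) + u = -(l • (w + v)))
    exact hrel 1 (l - 1) (Or.inl one_ne_zero) (by linear_combination (norm := module) h0)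
  | 3 =>
    intro (h0 : u + v + w - u + -w = -(l • u))
    linarith [(h 1 l 0 hl le_rfl (by linear_combination (norm := module) h0)).1]
  | 4 =>
    intro (h0 : u + v + w - (v + w) + -w = -(l • (v + w)))
    exact hrel 1 (l - 1) (Or.inl one_ne_zero) (by linear_combination (norm := module) h0)

lemma logDefined {p : E3} (hp : p ∉ segment ℝ (p + v + u) (p + v + w)) (j : Fin 5) :
    LogDefined u v w j := by
  rw [LogDefined, parA_add_parB_sub_parC]
  exact ⟨h.logArg_add_pos hp j, h.logArg_add_pos' hp j⟩

lemma logDefined_of_regularPair {j : Fin 5} (hj : RegularPair u v w j) : LogDefined u v w j := by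
  have hc := h.parC_ne_zero j
  have h1 := (regular_iff hc).1 hj.1 1 (right_mem_Ioc.2 zero_lt_one)
  have h1' := (regular_iff hc).1 hj.2 1 (right_mem_Ioc.2 zero_lt_one)
  rw [one_smul] at h1 h1'
  rw [LogDefined, parA_add_parB_sub_parC]
  exact ⟨h1, h1'⟩

lemma edgeIntegral_eq_of_regularPair {j : Fin 5} (hj : RegularPair u v w j) :
    edgeIntegral u v w j = edgeFormula hIntegral u v w j := by
  have hc := h.parC_ne_zero j
  rw [h.edgeIntegral_eq (h.logDefined_of_regularPair hj), edgeFormula, edgeFormula,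
    (hIntegral_of_regular hc hj.1).2, (hIntegral_of_regular hc hj.2).2]

end EdgeCone

lemma eq_zero_of_linearIndependent {M : Type*} [AddCommGroup M] [Module ℝ M] {u v w : M}
    (hl : LinearIndependent ℝ ![u, v, w]) {α β γ : ℝ} (h0 : α • u + β • v + γ • w = 0) :
    α = 0 ∧ β = 0 ∧ γ = 0 := by
  have h := Fintype.linearIndependent_iff.1 hl ![α, β, γ] (by rw [Fin.sum_univ_three]; exact h0)
  exact ⟨h 0, h 1, h 2⟩

section LinearIndependent

variable {u v w : E3} (h : EdgeCone u v w) (hl : LinearIndependent ℝ ![u, v, w])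
include h hl

lemma regular_par (j : Fin 5) : Regular (parA u v w j) (parB u v w j) (parC u v w j) := by
  have hc := h.parC_ne_zero j
  have hrel := fun α β γ => eq_zero_of_linearIndependent hl (α := α) (β := β) (γ := γ)
  rw [regular_iff hc]
  intro η hη
  rw [logArg_pos_iff hc]
  intro l hl
  match j with
  | 0 =>
    intro (h0 : η • w + v = -(l • (u + v)))
    linarith [(hrel l (1 + l) η (by linear_combination (norm := module) h0)).2.1]
  | 1 =>
    intro (h0 : η • v + w = -(l • (u + v)))
    linarith [(hrel l (η + l) 1 (by linear_combination (norm := module) h0)).2.2]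
  | 2 =>
    intro (h0 : η • v + u = -(l • (w + v)))
    linarith [(hrel 1 (η + l) l (by linear_combination (norm := module) h0)).1]
  | 3 =>
    intro (h0 : η • (u + v + w) + -w = -(l • u))
    linarith [(hrel (η + l) η (η - 1) (by linear_combination (norm := module) h0)).2.1, hη.1]
  | 4 =>
    intro (h0 : η • (u + v + w) + -w = -(l • (v + w)))
    linarith [(hrel η (η + l) (η - 1 + l) (by linear_combination (norm := module) h0)).1, hη.1]

lemma regular_par' (j : Fin 5) : Regular (parA' u v w j) (parB' u v w j) (parC u v w j) := by
  have hc := h.parC_ne_zero j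
  have hrel := fun α β γ => eq_zero_of_linearIndependent hl (α := α) (β := β) (γ := γ)
  rw [regular_iff hc]
  intro η hη
  rw [logArg_pos_iff hc]
  intro l _
  match j with
  | 0 =>
    intro (h0 : η • w + (v - (u + v)) = -(l • (u + v)))
    linarith [(hrel (l - 1) l η (by linear_combination (norm := module) h0)).2.2, hη.1]
  | 1 =>
    intro (h0 : η • (v - (u + v)) + w = -(l • (u + v)))
    linarith [(hrel (l - η) l 1 (by linear_combination (norm := module) h0)).2.2]
  | 2 =>
    intro (h0 : η • (v - (w + v)) + u = -(l • (w + v)))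
    linarith [(hrel 1 l (l - η) (by linear_combination (norm := module) h0)).1]
  | 3 =>
    intro (h0 : η • (u + v + w - u) + -w = -(l • u))
    linarith [(hrel l η (η - 1) (by linear_combination (norm := module) h0)).2.1, hη.1]
  | 4 =>
    intro (h0 : η • (u + v + w - (v + w)) + -w = -(l • (v + w)))
    linarith [(hrel η l (l - 1) (by linear_combination (norm := module) h0)).1, hη.1]

end LinearIndependent

/-! ### The surface measure of a triangle -/

lemma measurableSet_refTriangle : MeasurableSet refTriangle :=
  (measurableSet_lt measurable_const measurable_fst).inter
    ((measurableSet_lt measurable_fst measurable_const).inter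
      ((measurableSet_lt measurable_const measurable_snd).inter
        (measurableSet_lt measurable_snd measurable_fst)))

lemma volume_refTriangle_lt_top : volume refTriangle < ⊤ := by
  refine (measure_mono (t := Icc (0 : ℝ) 1 ×ˢ Icc (0 : ℝ) 1) fun z hz => ?_).trans_lt
    (isCompact_Icc.prod isCompact_Icc).measure_lt_top
  obtain ⟨h1, h2, h3, h4⟩ := hz
  exact ⟨⟨h1.le, h2.le⟩, h3.le, (h4.trans h2).le⟩

/-- The linear part of the reference mapping `chi p e f`, on Euclidean space, where the Hausdorff
measure of the image of a linear map is known. -/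
def chiLinear (e f : E3) : EuclideanSpace ℝ (Fin 2) →ₗ[ℝ] E3 where
  toFun y := y 0 • e + y 1 • f
  map_add' x y := by simp only [PiLp.add_apply]; module
  map_smul' r x := by simp only [PiLp.smul_apply, smul_eq_mul, RingHom.id_apply]; module

lemma normDet_chiLinear (e f : E3) : (chiLinear e f).normDet = gramRoot e f := by
  have h := (chiLinear e f).normDet_sq_eq_det_gram (EuclideanSpace.basisFun (Fin 2) ℝ)
  have h0 : chiLinear e f (EuclideanSpace.basisFun (Fin 2) ℝ 0) = e := by simp [chiLinear]
  have h1 : chiLinear e f (EuclideanSpace.basisFun (Fin 2) ℝ 1) = f := by simp [chiLinear]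
  rw [Matrix.det_fin_two] at h
  simp only [Matrix.gram_apply, h0, h1, real_inner_comm e f, real_inner_self_eq_norm_sq,
    RCLike.ofReal_real_eq_id, id] at h
  rw [gramRoot_eq, ← Real.sqrt_sq (chiLinear e f).normDet_nonneg, h]
  congr 1
  ring

lemma continuous_chi (p e f : E3) : Continuous (chi p e f) := by
  unfold chi; fun_prop

lemma euclideanHausdorffMeasure_chi_image (p e f : E3) {A : Set (ℝ × ℝ)} (hA : MeasurableSet A) :
    (μHE[2] : Measure E3) (chi p e f '' A) = ENNReal.ofReal (gramRoot e f) * volume A := by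
  set coords := fun y : EuclideanSpace ℝ (Fin 2) => ((y 0, y 1) : ℝ × ℝ) with coords_def
  have coords_preserving : MeasurePreserving coords :=
    (volume_preserving_finTwoArrow ℝ).comp (PiLp.volume_preserving_ofLp (Fin 2))
  have coords_surjective : Function.Surjective coords := fun z => ⟨!₂[z.1, z.2], by simp [coords]⟩
  have chi_coords : chi p e f ∘ coords = (p + ·) ∘ chiLinear e f := by
    ext1 y
    simp only [chi, coords_def, chiLinear, Function.comp_apply, LinearMap.coe_mk, AddHom.coe_mk,
      add_assoc]
  have h := (chiLinear e f).euclideanHausdorffMeasure_image_eq_normDet_mul_volume (coords ⁻¹' A)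
  rw [finrank_euclideanSpace_fin, normDet_chiLinear,
    coords_preserving.measure_preimage hA.nullMeasurableSet,
    ← (isometry_add_left p).euclideanHausdorffMeasure_image, ← image_comp, ← chi_coords,
    image_comp, image_preimage_eq A coords_surjective] at h
  exact h

lemma restrict_triangle (p e f : E3) : (μHE[2] : Measure E3).restrict (triangle p e f) =
    ENNReal.ofReal (gramRoot e f) • (volume.restrict refTriangle).map (chi p e f) := by
  have hm := (continuous_chi p e f).measurable
  ext s hs
  rw [Measure.restrict_apply hs, triangle, Measure.smul_apply, Measure.map_apply hm hs,
    Measure.restrict_apply (hm hs), inter_comm, ← image_inter_preimage,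
    euclideanHausdorffMeasure_chi_image p e f (measurableSet_refTriangle.inter (hm hs)), inter_comm,
    smul_eq_mul]

lemma lintegral_triangle (p e f : E3) {F : E3 → ENNReal} (hF : Measurable F) :
    ∫⁻ y in triangle p e f, F y ∂(μHE[2] : Measure E3) =
      ENNReal.ofReal (gramRoot e f) * ∫⁻ z in refTriangle, F (chi p e f z) := by
  rw [restrict_triangle, lintegral_smul_measure, lintegral_map hF (continuous_chi p e f).measurable,
    smul_eq_mul]

instance isFiniteMeasure_restrict_triangle (p e f : E3) :
    IsFiniteMeasure ((μHE[2] : Measure E3).restrict (triangle p e f)) := by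
  constructor
  rw [← lintegral_one, lintegral_triangle p e f measurable_const, lintegral_one,
    Measure.restrict_apply_univ]
  exact ENNReal.mul_lt_top ENNReal.ofReal_lt_top volume_refTriangle_lt_top

/-! ### Integrals of homogeneous functions over truncated cones -/

section Homogeneous

variable {V W : Type*} [SMul ℝ V] [SMul ℝ W]

/-- Homogeneity of degree `-1` with respect to positive real factors. -/
def HomogeneousNegOne (φ : V → ENNReal) : Prop :=
  ∀ t : ℝ, 0 < t → ∀ v, φ (t • v) = ENNReal.ofReal t⁻¹ * φ v

lemma HomogeneousNegOne.comp {φ : W → ENNReal} (h : HomogeneousNegOne φ) {L : V → W}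
    (hL : ∀ (t : ℝ) v, L (t • v) = t • L v) : HomogeneousNegOne fun v => φ (L v) :=
  fun t ht v => (congrArg φ (hL t v)).trans (h t ht (L v))

/-- The open cone with apex `0` over the base `K`, placed at height `1`, and truncated at
that height. The first coordinate is the height. -/
def truncatedCone (K : Set V) : Set (ℝ × V) := {z | z.1 ∈ Ioo 0 1 ∧ z.1⁻¹ • z.2 ∈ K}

end Homogeneous

lemma measurableSet_truncatedCone {V : Type*} [NormedAddCommGroup V] [NormedSpace ℝ V]
    [MeasurableSpace V] [BorelSpace V] [SecondCountableTopology V] {K : Set V}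
    (hK : MeasurableSet K) : MeasurableSet (truncatedCone K) :=
  (measurable_fst measurableSet_Ioo).inter
    ((by fun_prop : Measurable fun z : ℝ × V => z.1⁻¹ • z.2) hK)

section Cone

variable {V : Type*} [NormedAddCommGroup V] [NormedSpace ℝ V] [FiniteDimensional ℝ V]
  [MeasurableSpace V] [BorelSpace V] (μ : Measure V) [μ.IsAddHaarMeasure]

lemma lintegral_smul_comp {g : V → ENNReal} (hg : Measurable g) {t : ℝ} (ht : 0 < t) :
    ∫⁻ v, g v ∂μ = ENNReal.ofReal (t ^ Module.finrank ℝ V) * ∫⁻ v, g (t • v) ∂μ := by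
  rw [← lintegral_map hg (measurable_const_smul t), Measure.map_addHaar_smul μ ht.ne',
    lintegral_smul_measure, smul_eq_mul, ← mul_assoc, ← ENNReal.ofReal_mul (by positivity),
    abs_of_pos (by positivity), mul_inv_cancel₀ (by positivity), ENNReal.ofReal_one, one_mul]

lemma lintegral_truncatedCone {K : Set V} (hK : MeasurableSet K) {f : ℝ × V → ENNReal}
    (hf : Measurable f) :
    ∫⁻ z in truncatedCone K, f z ∂(volume.prod μ) =
      ∫⁻ t in Ioo (0 : ℝ) 1, ENNReal.ofReal (t ^ Module.finrank ℝ V) *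
        ∫⁻ v in K, f (t, t • v) ∂μ := by
  have hC := measurableSet_truncatedCone hK
  rw [← lintegral_indicator hC, lintegral_prod _ (hf.indicator hC).aemeasurable,
    ← lintegral_indicator measurableSet_Ioo]
  refine lintegral_congr fun t => ?_
  by_cases ht : t ∈ Ioo (0 : ℝ) 1
  · have slice_measurable : Measurable fun v => (truncatedCone K).indicator f (t, v) :=
      (hf.indicator hC).comp measurable_prodMk_left
    rw [indicator_of_mem ht, ← lintegral_indicator hK, lintegral_smul_comp μ slice_measurable ht.1]
    congr 1
    refine lintegral_congr fun v => ?_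
    have mem_iff : (t, t • v) ∈ truncatedCone K ↔ v ∈ K := by
      rw [truncatedCone, mem_ofPred_eq, inv_smul_smul₀ ht.1.ne', and_iff_right ht]
    by_cases hv : v ∈ K
    · rw [indicator_of_mem hv]
      exact indicator_of_mem (mem_iff.2 hv) f
    · rw [indicator_of_notMem hv]
      exact indicator_of_notMem (mt mem_iff.1 hv) f
  · rw [indicator_of_notMem ht]
    exact (lintegral_congr fun v => indicator_of_notMem (fun h => ht h.1) f).trans lintegral_zero

lemma setLIntegral_Ioo_pow (n : ℕ) :
    ∫⁻ t in Ioo (0 : ℝ) 1, ENNReal.ofReal (t ^ n) = ENNReal.ofReal (1 / (n + 1)) := by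
  rw [← ofReal_integral_eq_lintegral_ofReal]
  · rw [← integral_Ioc_eq_integral_Ioo, ← intervalIntegral.integral_of_le zero_le_one,
      integral_pow, one_pow, zero_pow n.succ_ne_zero, sub_zero]
  · exact ((continuous_pow n).integrableOn_Icc (a := 0) (b := 1)).mono_set Ioo_subset_Icc_self
  · filter_upwards [ae_restrict_mem measurableSet_Ioo] with t ht
    exact pow_nonneg ht.1.le n

/-- The radial integral is `∫₀¹ tⁿ⁻¹ dt`: the singularity at the apex is absorbed by the volume
element. -/
lemma lintegral_truncatedCone_of_homogeneous [Nontrivial V] {K : Set V} (hK : MeasurableSet K)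
    {φ : ℝ × V → ENNReal} (hφ : Measurable φ) (hom : HomogeneousNegOne φ) :
    ∫⁻ z in truncatedCone K, φ z ∂(volume.prod μ) =
      ENNReal.ofReal (1 / Module.finrank ℝ V) * ∫⁻ v in K, φ (1, v) ∂μ := by
  obtain ⟨n, hn⟩ := Nat.exists_eq_succ_of_ne_zero (Module.finrank_pos (R := ℝ) (M := V)).ne'
  have scale : ∀ t ∈ Ioo (0 : ℝ) 1, ENNReal.ofReal (t ^ (n + 1)) * ∫⁻ v in K, φ (t, t • v) ∂μ =
      ENNReal.ofReal (t ^ n) * ∫⁻ v in K, φ (1, v) ∂μ := by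
    intro t ht
    have ht0 : 0 < t := ht.1
    have hom_t : ∀ v : V, φ (t, t • v) = ENNReal.ofReal t⁻¹ * φ (1, v) := fun v => by
      rw [← hom t ht0, Prod.smul_mk, smul_eq_mul, mul_one]
    have slice_measurable : Measurable fun v => φ (1, v) := hφ.comp measurable_prodMk_left
    simp_rw [hom_t]
    rw [lintegral_const_mul _ slice_measurable, ← mul_assoc,
      ← ENNReal.ofReal_mul (by positivity), pow_succ, mul_assoc, mul_inv_cancel₀ ht0.ne', mul_one]
  rw [lintegral_truncatedCone μ hK hφ, hn, Nat.succ_eq_add_one,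
    setLIntegral_congr_fun measurableSet_Ioo scale, lintegral_mul_const _ (by fun_prop),
    setLIntegral_Ioo_pow, Nat.cast_add_one]

lemma setLIntegral_eq_add_of_ne_zero {L : V →ₗ[ℝ] ℝ} (hL : L ≠ 0) (s : Set V) (f : V → ENNReal) :
    ∫⁻ v in s, f v ∂μ = ∫⁻ v in s ∩ {v | 0 < L v}, f v ∂μ + ∫⁻ v in s ∩ {v | L v < 0}, f v ∂μ := by
  have hLm : Measurable L := L.continuous_of_finiteDimensional.measurable
  have ker_null : μ (L.ker : Set V) = 0 :=
    Measure.addHaar_submodule μ _ (mt LinearMap.ker_eq_top.1 hL)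
  have neg_ae_eq : (s ∩ {v | L v < 0} : Set V) =ᵐ[μ] (s \ {v | 0 < L v} : Set V) := by
    filter_upwards [measure_eq_zero_iff_ae_notMem.1 ker_null] with v hv
    have hv' : L v ≠ 0 := hv
    refine propext (and_congr_right fun _ => ?_)
    exact ⟨fun (h : L v < 0) (h' : 0 < L v) => lt_asymm h h',
      fun (h : ¬0 < L v) => (not_lt.1 h).lt_of_ne hv'⟩
  rw [setLIntegral_congr neg_ae_eq, lintegral_inter_add_sdiff f s
    (measurableSet_lt measurable_const hLm)]

end Cone

instance isAddHaarMeasure_volume_prod {V W : Type*} [AddGroup V] [TopologicalSpace V]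
    [MeasureSpace V] [AddGroup W] [TopologicalSpace W] [MeasureSpace W] [MeasurableAdd V]
    [MeasurableAdd W] [SFinite (volume : Measure V)] [SFinite (volume : Measure W)]
    [(volume : Measure V).IsAddHaarMeasure] [(volume : Measure W).IsAddHaarMeasure] :
    (volume : Measure (V × W)).IsAddHaarMeasure :=
  Measure.prod.instIsAddHaarMeasure volume volume

/-! ### Integrals over pairs of reference triangles -/

lemma measurableSet_unitSquare : MeasurableSet unitSquare :=
  measurableSet_Ioo.prod measurableSet_Ioo

lemma inv_smul_mem_refTriangle {t : ℝ} (ht : 0 < t) {z : ℝ × ℝ} :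
    t⁻¹ • z ∈ refTriangle ↔ 0 < z.1 ∧ z.1 < t ∧ 0 < z.2 ∧ z.2 < z.1 := by
  simp only [refTriangle, mem_ofPred_eq, Prod.smul_fst, Prod.smul_snd, smul_eq_mul,
    mul_pos_iff_of_pos_left (inv_pos.2 ht), mul_lt_mul_iff_right₀ (inv_pos.2 ht),
    inv_mul_lt_one₀ ht]

lemma inv_mul_mem_Ioo {t : ℝ} (ht : 0 < t) {s : ℝ} : t⁻¹ * s ∈ Ioo 0 1 ↔ 0 < s ∧ s < t := by
  rw [mem_Ioo, mul_pos_iff_of_pos_left (inv_pos.2 ht), inv_mul_lt_one₀ ht]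

lemma refTriangle_eq_truncatedCone : refTriangle = truncatedCone (Ioo (0 : ℝ) 1) := by
  ext z
  constructor
  · rintro ⟨h1, h2, h3⟩
    exact ⟨⟨h1, h2⟩, (inv_mul_mem_Ioo h1).2 h3⟩
  · rintro ⟨⟨h1, h2⟩, h3⟩
    exact ⟨h1, h2, (inv_mul_mem_Ioo h1).1 h3⟩

lemma setLIntegral_refTriangle {f : ℝ × ℝ → ENNReal} (hf : Measurable f) :
    ∫⁻ z in refTriangle, f z =
      ∫⁻ z in unitSquare, ENNReal.ofReal z.1 * f (z.1, z.2 * z.1) := by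
  have hm : Measurable fun z : ℝ × ℝ => ENNReal.ofReal z.1 * f (z.1, z.2 * z.1) :=
    (by fun_prop : Measurable fun z : ℝ × ℝ => ENNReal.ofReal z.1).mul
      (hf.comp (by fun_prop : Measurable fun z : ℝ × ℝ => (z.1, z.2 * z.1)))
  rw [refTriangle_eq_truncatedCone, Measure.volume_eq_prod,
    lintegral_truncatedCone volume measurableSet_Ioo hf, unitSquare, ← Measure.prod_restrict,
    lintegral_prod _ hm.aemeasurable]
  refine lintegral_congr fun t => ?_
  have slice_measurable : Measurable fun s => f (t, s * t) :=
    hf.comp (by fun_prop : Measurable fun s : ℝ => (t, s * t))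
  simp only [Module.finrank_self, pow_one, smul_eq_mul, mul_comm t]
  exact (lintegral_const_mul _ slice_measurable).symm

lemma setLIntegral_unitSquare_eq_add {f : ℝ × ℝ → ENNReal} (hf : Measurable f) :
    ∫⁻ z in unitSquare, f z =
      (∫⁻ z in unitSquare, ENNReal.ofReal z.1 * f (z.1, z.2 * z.1)) +
        ∫⁻ z in unitSquare, ENNReal.ofReal z.1 * f (z.2 * z.1, z.1) := by
  have diagonal_ne_zero : LinearMap.fst ℝ ℝ ℝ - LinearMap.snd ℝ ℝ ℝ ≠ 0 := fun h => by
    simpa using LinearMap.congr_fun h (1, 0)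
  have lower : unitSquare ∩ {z | 0 < (LinearMap.fst ℝ ℝ ℝ - LinearMap.snd ℝ ℝ ℝ) z} =
      refTriangle := by
    ext z
    simp only [unitSquare, refTriangle, mem_inter_iff, mem_prod, mem_Ioo, mem_ofPred_eq,
      LinearMap.sub_apply, LinearMap.fst_apply, LinearMap.snd_apply, sub_pos]
    exact ⟨by grind, by grind⟩
  have upper : unitSquare ∩ {z | (LinearMap.fst ℝ ℝ ℝ - LinearMap.snd ℝ ℝ ℝ) z < 0} =
      Prod.swap ⁻¹' refTriangle := by
    ext z
    simp only [unitSquare, refTriangle, mem_inter_iff, mem_prod, mem_Ioo, mem_ofPred_eq,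
      LinearMap.sub_apply, LinearMap.fst_apply, LinearMap.snd_apply, sub_neg, mem_preimage,
      Prod.fst_swap, Prod.snd_swap]
    exact ⟨by grind, by grind⟩
  have hf' : Measurable (f ∘ Prod.swap) := hf.comp measurable_swap
  have swapped : ∫⁻ z in Prod.swap ⁻¹' refTriangle, f z = ∫⁻ z in refTriangle, f z.swap :=
    Measure.measurePreserving_swap.setLIntegral_comp_preimage measurableSet_refTriangle hf'
  rw [setLIntegral_eq_add_of_ne_zero volume diagonal_ne_zero, lower, upper, swapped,
    setLIntegral_refTriangle hf]
  exact congrArg _ (setLIntegral_refTriangle hf')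

lemma measurePreserving_shear :
    MeasurePreserving fun z : ℝ × ℝ => ((1 - z.2, z.1 - z.2) : ℝ × ℝ) :=
  ((Measure.measurePreserving_sub_left volume 1).prod (MeasurePreserving.id volume)).comp
    (Measure.measurePreserving_swap.comp (measurePreserving_sub_prod volume volume))

lemma shear_preimage_refTriangle :
    (fun z : ℝ × ℝ => ((1 - z.2, z.1 - z.2) : ℝ × ℝ)) ⁻¹' refTriangle = refTriangle := by
  ext z
  simp only [refTriangle, mem_preimage, mem_ofPred_eq, sub_pos, sub_lt_sub_iff_right]
  exact ⟨by grind, by grind⟩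

section HomogeneousKernel

variable {ψ : ℝ × ℝ × ℝ → ENNReal} (hψ : Measurable ψ)
include hψ

lemma setLIntegral_shear :
    ∫⁻ v in Ioo (0 : ℝ) 1 ×ˢ refTriangle, ψ (v.2.1 - 1, v.2.2, v.1) =
      ∫⁻ v in Ioo (0 : ℝ) 1 ×ˢ refTriangle, ψ (-v.2.2, v.2.1 - v.2.2, v.1) := by
  have hS : MeasurableSet (Ioo (0 : ℝ) 1 ×ˢ refTriangle) :=
    measurableSet_Ioo.prod measurableSet_refTriangle
  have h := ((MeasurePreserving.id (volume : Measure ℝ)).prod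
    measurePreserving_shear).setLIntegral_comp_preimage hS
    (hψ.comp (by fun_prop : Measurable fun v : ℝ × ℝ × ℝ => (v.2.1 - 1, v.2.2, v.1)))
  rw [preimage_prod_map_prod, preimage_id, shear_preimage_refTriangle] at h
  refine h.symm.trans (lintegral_congr fun v => ?_)
  simp only [Function.comp_apply, Prod.map_fst, Prod.map_snd, id_eq, sub_sub_cancel_left]

variable (hom : HomogeneousNegOne ψ)
include hom

/-- Scaling by the largest of the four coordinates, which is the first coordinate of `x`. -/
lemma setLIntegral_pair_lt_eq_mul :
    ∫⁻ q in refTriangle ×ˢ refTriangle ∩ {q | q.2.1 < q.1.1},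
        ψ (q.2.1 - q.1.1, q.2.2, q.1.2) =
      ENNReal.ofReal (1 / 3) *
        ∫⁻ v in Ioo (0 : ℝ) 1 ×ˢ refTriangle, ψ (v.2.1 - 1, v.2.2, v.1) := by
  have hφ : Measurable fun z : ℝ × ℝ × ℝ × ℝ => ψ (z.2.2.1 - z.1, z.2.2.2, z.2.1) :=
    hψ.comp (by fun_prop)
  have homφ : HomogeneousNegOne fun z : ℝ × ℝ × ℝ × ℝ => ψ (z.2.2.1 - z.1, z.2.2.2, z.2.1) :=
    hom.comp fun t z => by
      simp only [Prod.smul_fst, Prod.smul_snd, Prod.smul_mk, smul_eq_mul, mul_sub]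
  have hK : MeasurableSet (Ioo (0 : ℝ) 1 ×ˢ refTriangle) :=
    measurableSet_Ioo.prod measurableSet_refTriangle
  have eq_preimage : refTriangle ×ˢ refTriangle ∩ {q | q.2.1 < q.1.1} =
      MeasurableEquiv.prodAssoc ⁻¹' truncatedCone (Ioo (0 : ℝ) 1 ×ˢ refTriangle) := by
    ext ⟨x, y⟩
    constructor
    · rintro ⟨⟨⟨hx, hx1, hx2⟩, hy, _, hy2⟩, hlt⟩
      exact ⟨⟨hx, hx1⟩, (inv_mul_mem_Ioo hx).2 hx2, (inv_smul_mem_refTriangle hx).2 ⟨hy, hlt, hy2⟩⟩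
    · rintro ⟨⟨hx, hx1⟩, hx2, hy⟩
      obtain ⟨hy, hlt, hy2⟩ := (inv_smul_mem_refTriangle hx).1 hy
      exact ⟨⟨⟨hx, hx1, (inv_mul_mem_Ioo hx).1 hx2⟩, hy, lt_trans hlt hx1, hy2⟩, hlt⟩
  rw [eq_preimage]
  refine (volume_preserving_prodAssoc.setLIntegral_comp_preimage
    (measurableSet_truncatedCone hK) hφ).trans ?_
  refine (lintegral_truncatedCone_of_homogeneous volume hK hφ homφ).trans ?_
  norm_num [Module.finrank_prod]

/-- Scaling by `v.2.1`, the larger one of `v.1` and `v.2.1`. -/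
lemma setLIntegral_triple_lt :
    ∫⁻ v in Ioo (0 : ℝ) 1 ×ˢ refTriangle ∩ {v | v.1 < v.2.1}, ψ (-v.2.2, v.2.1 - v.2.2, v.1) =
      ENNReal.ofReal (1 / 2) * ∫⁻ z in unitSquare, ψ (-z.1, 1 - z.1, z.2) := by
  have hφ : Measurable fun z : ℝ × ℝ × ℝ => ψ (-z.2.1, z.1 - z.2.1, z.2.2) :=
    hψ.comp (by fun_prop)
  have homφ : HomogeneousNegOne fun z : ℝ × ℝ × ℝ => ψ (-z.2.1, z.1 - z.2.1, z.2.2) :=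
    hom.comp fun t z => by
      simp only [Prod.smul_fst, Prod.smul_snd, Prod.smul_mk, smul_eq_mul, mul_sub, mul_neg]
  have rotation : MeasurePreserving
      fun v : ℝ × ℝ × ℝ => (MeasurableEquiv.prodAssoc v.swap : ℝ × ℝ × ℝ) :=
    volume_preserving_prodAssoc.comp Measure.measurePreserving_swap
  have eq_preimage : Ioo (0 : ℝ) 1 ×ˢ refTriangle ∩ {v | v.1 < v.2.1} =
      (fun v => MeasurableEquiv.prodAssoc v.swap) ⁻¹' truncatedCone unitSquare := by
    ext ⟨x, t, s⟩
    constructor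
    · rintro ⟨⟨hx, ht, ht1, hs⟩, hlt⟩
      exact ⟨⟨ht, ht1⟩, (inv_mul_mem_Ioo ht).2 hs, (inv_mul_mem_Ioo ht).2 ⟨hx.1, hlt⟩⟩
    · rintro ⟨⟨ht, ht1⟩, hs, hx⟩
      obtain ⟨hx, hlt⟩ := (inv_mul_mem_Ioo ht).1 hx
      exact ⟨⟨⟨hx, lt_trans hlt ht1⟩, ht, ht1, (inv_mul_mem_Ioo ht).1 hs⟩, hlt⟩
  rw [eq_preimage]
  refine (rotation.setLIntegral_comp_preimage
    (measurableSet_truncatedCone measurableSet_unitSquare) hφ).trans ?_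
  refine (lintegral_truncatedCone_of_homogeneous volume measurableSet_unitSquare hφ homφ).trans ?_
  norm_num [Module.finrank_prod]

/-- Scaling by `v.1`, the larger one of `v.1` and `v.2.1`. -/
lemma setLIntegral_triple_gt :
    ∫⁻ v in Ioo (0 : ℝ) 1 ×ˢ refTriangle ∩ {v | v.2.1 < v.1}, ψ (-v.2.2, v.2.1 - v.2.2, v.1) =
      ENNReal.ofReal (1 / 2) *
        ∫⁻ z in unitSquare, ENNReal.ofReal z.1 * ψ (-(z.2 * z.1), z.1 - z.2 * z.1, 1) := by
  have hφ : Measurable fun v : ℝ × ℝ × ℝ => ψ (-v.2.2, v.2.1 - v.2.2, v.1) :=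
    hψ.comp (by fun_prop)
  have homφ : HomogeneousNegOne fun v : ℝ × ℝ × ℝ => ψ (-v.2.2, v.2.1 - v.2.2, v.1) :=
    hom.comp fun t v => by
      simp only [Prod.smul_fst, Prod.smul_snd, Prod.smul_mk, smul_eq_mul, mul_sub, mul_neg]
  have eq_cone : Ioo (0 : ℝ) 1 ×ˢ refTriangle ∩ {v | v.2.1 < v.1} =
      truncatedCone refTriangle := by
    ext ⟨x, z⟩
    constructor
    · rintro ⟨⟨hx, ht, _, hs⟩, hlt⟩
      exact ⟨hx, (inv_smul_mem_refTriangle hx.1).2 ⟨ht, hlt, hs⟩⟩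
    · rintro ⟨hx, hz⟩
      obtain ⟨ht, hlt, hs⟩ := (inv_smul_mem_refTriangle hx.1).1 hz
      exact ⟨⟨hx, ht, lt_trans hlt hx.2, hs⟩, hlt⟩
  rw [eq_cone, ← setLIntegral_refTriangle (f := fun z => ψ (-z.2, z.1 - z.2, 1))
    (hψ.comp (by fun_prop))]
  refine (lintegral_truncatedCone_of_homogeneous volume measurableSet_refTriangle hφ homφ).trans ?_
  norm_num [Module.finrank_prod]

lemma setLIntegral_pair_lt :
    ∫⁻ q in refTriangle ×ˢ refTriangle ∩ {q | q.2.1 < q.1.1},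
        ψ (q.2.1 - q.1.1, q.2.2, q.1.2) =
      ENNReal.ofReal (1 / 6) * ((∫⁻ z in unitSquare, ψ (-z.1, 1 - z.1, z.2)) +
        ∫⁻ z in unitSquare, ENNReal.ofReal z.1 * ψ (-(z.2 * z.1), z.1 - z.2 * z.1, 1)) := by
  let L : ℝ × ℝ × ℝ →ₗ[ℝ] ℝ :=
    LinearMap.fst ℝ ℝ ℝ ∘ₗ LinearMap.snd ℝ ℝ (ℝ × ℝ) - LinearMap.fst ℝ ℝ (ℝ × ℝ)
  have hL : L ≠ 0 := fun h => by simpa [L] using LinearMap.congr_fun h (1, 0, 0)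
  have lt_eq : {v | 0 < L v} = {v : ℝ × ℝ × ℝ | v.1 < v.2.1} :=
    ext fun v => (sub_pos : 0 < v.2.1 - v.1 ↔ _)
  have gt_eq : {v | L v < 0} = {v : ℝ × ℝ × ℝ | v.2.1 < v.1} :=
    ext fun v => (sub_neg : v.2.1 - v.1 < 0 ↔ _)
  rw [setLIntegral_pair_lt_eq_mul hψ hom, setLIntegral_shear hψ,
    setLIntegral_eq_add_of_ne_zero volume hL, lt_eq, gt_eq, setLIntegral_triple_lt hψ hom,
    setLIntegral_triple_gt hψ hom, ← mul_add, ← mul_assoc, ← ENNReal.ofReal_mul (by positivity)]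
  norm_num only

lemma setLIntegral_pair_gt :
    ∫⁻ q in refTriangle ×ˢ refTriangle ∩ {q | q.1.1 < q.2.1},
        ψ (q.2.1 - q.1.1, q.2.2, q.1.2) =
      ENNReal.ofReal (1 / 6) *
        (((∫⁻ z in unitSquare, ENNReal.ofReal z.1 * ψ (z.1, z.2 * z.1, 1 - z.1)) +
          ∫⁻ z in unitSquare, ENNReal.ofReal z.1 * ψ (z.2 * z.1, z.1, 1 - z.2 * z.1)) +
        ∫⁻ z in unitSquare, ENNReal.ofReal z.1 * ψ (z.2 * z.1, 1, z.1 - z.2 * z.1)) := by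
  have hφ : Measurable fun z : ℝ × ℝ × ℝ => ψ (-z.1, z.2.2, z.2.1) := hψ.comp (by fun_prop)
  have homφ : HomogeneousNegOne fun z : ℝ × ℝ × ℝ => ψ (-z.1, z.2.2, z.2.1) :=
    hom.comp fun t z => by
      simp only [Prod.smul_fst, Prod.smul_snd, Prod.smul_mk, smul_eq_mul, mul_neg]
  have h := setLIntegral_pair_lt hφ homφ
  simp only [neg_neg, neg_sub] at h
  rw [setLIntegral_unitSquare_eq_add (f := fun z => ψ (z.1, z.2, 1 - z.1))
    (hψ.comp (by fun_prop))] at h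
  have swap_preimage : refTriangle ×ˢ refTriangle ∩ {q | q.1.1 < q.2.1} =
      Prod.swap ⁻¹' (refTriangle ×ˢ refTriangle ∩ {q | q.2.1 < q.1.1}) := by
    rw [preimage_inter, preimage_swap_prod]; rfl
  have hS : MeasurableSet
      (refTriangle ×ˢ refTriangle ∩ {q : (ℝ × ℝ) × (ℝ × ℝ) | q.2.1 < q.1.1}) :=
    (measurableSet_refTriangle.prod measurableSet_refTriangle).inter
      (measurableSet_lt (by fun_prop) (by fun_prop))
  have hm : Measurable fun q : (ℝ × ℝ) × (ℝ × ℝ) => ψ (q.1.1 - q.2.1, q.1.2, q.2.2) :=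
    hψ.comp (by fun_prop)
  rw [← h, swap_preimage]
  exact Measure.measurePreserving_swap.setLIntegral_comp_preimage hS hm

theorem lintegral_refTriangle_pair :
    ∫⁻ x in refTriangle, ∫⁻ y in refTriangle, ψ (y.1 - x.1, y.2, x.2) =
      ENNReal.ofReal (1 / 6) * ((∫⁻ z in unitSquare, ψ (-z.1, 1 - z.1, z.2)) +
        (∫⁻ z in unitSquare, ENNReal.ofReal z.1 * ψ (-(z.2 * z.1), z.1 - z.2 * z.1, 1)) +
        (∫⁻ z in unitSquare, ENNReal.ofReal z.1 * ψ (z.2 * z.1, 1, z.1 - z.2 * z.1)) +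
        (∫⁻ z in unitSquare, ENNReal.ofReal z.1 * ψ (z.1, z.2 * z.1, 1 - z.1)) +
        ∫⁻ z in unitSquare, ENNReal.ofReal z.1 * ψ (z.2 * z.1, z.1, 1 - z.2 * z.1)) := by
  let L : (ℝ × ℝ) × (ℝ × ℝ) →ₗ[ℝ] ℝ :=
    LinearMap.fst ℝ ℝ ℝ ∘ₗ (LinearMap.fst ℝ (ℝ × ℝ) (ℝ × ℝ) - LinearMap.snd ℝ (ℝ × ℝ) (ℝ × ℝ))
  have hL : L ≠ 0 := fun h => by simpa [L] using LinearMap.congr_fun h ((1, 0), 0)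
  have lt_eq : {q | 0 < L q} = {q : (ℝ × ℝ) × (ℝ × ℝ) | q.2.1 < q.1.1} :=
    ext fun q => (sub_pos : 0 < q.1.1 - q.2.1 ↔ _)
  have gt_eq : {q | L q < 0} = {q : (ℝ × ℝ) × (ℝ × ℝ) | q.1.1 < q.2.1} :=
    ext fun q => (sub_neg : q.1.1 - q.2.1 < 0 ↔ _)
  have hm : Measurable fun q : (ℝ × ℝ) × (ℝ × ℝ) => ψ (q.2.1 - q.1.1, q.2.2, q.1.2) :=
    hψ.comp (by fun_prop)
  rw [← lintegral_prod _ hm.aemeasurable, Measure.prod_restrict, ← Measure.volume_eq_prod,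
    setLIntegral_eq_add_of_ne_zero volume hL, lt_eq, gt_eq, setLIntegral_pair_lt hψ hom,
    setLIntegral_pair_gt hψ hom, ← mul_add]
  congr 1
  ring

end HomogeneousKernel

/-! ### The single layer integral -/

lemma fundSol_nonneg (x y : E3) : 0 ≤ fundSol x y :=
  one_div_nonneg.2 (mul_nonneg (mul_nonneg zero_le_four Real.pi_pos.le) (norm_nonneg _))

lemma measurable_fundSol : Measurable fun z : E3 × E3 => fundSol z.1 z.2 := by
  unfold fundSol; fun_prop

lemma gramRoot_nonneg (e f : E3) : 0 ≤ gramRoot e f := Real.sqrt_nonneg _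

lemma edgeIntegrand_nonneg (u v w : E3) (j : Fin 5) {z : ℝ × ℝ} (hz : z ∈ unitSquare) :
    0 ≤ edgeIntegrand u v w j z := by
  have hz1 : 0 ≤ z.1 := hz.1.1.le
  match j with
  | 0 => exact one_div_nonneg.2 (norm_nonneg _)
  | 1 | 2 | 3 | 4 => exact div_nonneg hz1 (norm_nonneg _)

lemma edgeIntegral_nonneg (u v w : E3) (j : Fin 5) : 0 ≤ edgeIntegral u v w j :=
  setIntegral_nonneg measurableSet_unitSquare fun _ hz => edgeIntegrand_nonneg u v w j hz

lemma EdgeCone.lintegral_edgeIntegrand {u v w : E3} (h : EdgeCone u v w) (j : Fin 5) :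
    ∫⁻ z in unitSquare, ENNReal.ofReal (edgeIntegrand u v w j z) =
      ENNReal.ofReal (edgeIntegral u v w j) := by
  rw [edgeIntegral, ofReal_integral_eq_lintegral_ofReal (h.integrableOn_edgeIntegrand j)]
  filter_upwards [ae_restrict_mem measurableSet_unitSquare] with z hz
  exact edgeIntegrand_nonneg u v w j hz

/-- The kernel `1 / |y - x|` at the points with parameters `(y₁, y₂)` of `τ` and `(x₁, x₂)` of `σ`,
as a function of the relative coordinates `q = (y₁ - x₁, y₂, x₂)`. -/
noncomputable def relKernel (u v w : E3) (q : ℝ × ℝ × ℝ) : ENNReal :=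
  ENNReal.ofReal (1 / ‖q.1 • v + q.2.1 • u - q.2.2 • w‖)

lemma measurable_relKernel (u v w : E3) : Measurable (relKernel u v w) := by
  unfold relKernel; fun_prop

lemma homogeneousNegOne_relKernel (u v w : E3) : HomogeneousNegOne (relKernel u v w) := by
  intro t ht q
  simp only [relKernel, Prod.smul_fst, Prod.smul_snd, smul_assoc]
  rw [← ENNReal.ofReal_mul (by positivity), ← smul_add, ← smul_sub, norm_smul,
    Real.norm_of_nonneg ht.le, one_div, mul_inv, one_div]

lemma ofReal_mul_relKernel (u v w : E3) {t : ℝ} (ht : 0 ≤ t) (q : ℝ × ℝ × ℝ) :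
    ENNReal.ofReal t * relKernel u v w q =
      ENNReal.ofReal (t / ‖q.1 • v + q.2.1 • u - q.2.2 • w‖) := by
  rw [relKernel, ← ENNReal.ofReal_mul ht, mul_one_div]

lemma ofReal_edgeIntegrand (u v w : E3) (j : Fin 5) {z : ℝ × ℝ} (hz : z ∈ unitSquare) :
    ENNReal.ofReal (edgeIntegrand u v w j z) =
      ![relKernel u v w (-z.1, 1 - z.1, z.2),
        ENNReal.ofReal z.1 * relKernel u v w (-(z.2 * z.1), z.1 - z.2 * z.1, 1),
        ENNReal.ofReal z.1 * relKernel u v w (z.2 * z.1, 1, z.1 - z.2 * z.1),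
        ENNReal.ofReal z.1 * relKernel u v w (z.1, z.2 * z.1, 1 - z.1),
        ENNReal.ofReal z.1 * relKernel u v w (z.2 * z.1, z.1, 1 - z.2 * z.1)] j := by
  have hz1 : 0 ≤ z.1 := hz.1.1.le
  simp only [ofReal_mul_relKernel u v w hz1]
  match j with
  | 0 | 1 =>
    simp only [edgeIntegrand, relKernel, Matrix.cons_val]
    rw [← norm_neg]
    congr 3
    module
  | 2 | 3 | 4 =>
    simp only [edgeIntegrand, Matrix.cons_val]
    congr 3
    module

lemma EdgeCone.lintegral_relKernel {u v w : E3} (h : EdgeCone u v w) :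
    ∫⁻ x in refTriangle, ∫⁻ y in refTriangle, relKernel u v w (y.1 - x.1, y.2, x.2) =
      ENNReal.ofReal (1 / 6 * ∑ j, edgeIntegral u v w j) := by
  rw [lintegral_refTriangle_pair (measurable_relKernel u v w) (homogeneousNegOne_relKernel u v w),
    ENNReal.ofReal_mul (by norm_num),
    ENNReal.ofReal_sum_of_nonneg fun j _ => edgeIntegral_nonneg u v w j]
  simp only [← h.lintegral_edgeIntegrand,
    setLIntegral_congr_fun measurableSet_unitSquare fun _ => ofReal_edgeIntegrand u v w _,
    Fin.sum_univ_five, Matrix.cons_val]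

lemma ofReal_fundSol_chi (p u v w : E3) (x y : ℝ × ℝ) :
    ENNReal.ofReal (fundSol (chi p v w x) (chi p v u y)) =
      ENNReal.ofReal (1 / (4 * Real.pi)) * relKernel u v w (y.1 - x.1, y.2, x.2) := by
  have difference : chi p v u y - chi p v w x = (y.1 - x.1) • v + y.2 • u - x.2 • w := by
    unfold chi; module
  rw [ofReal_mul_relKernel u v w (by positivity), fundSol, difference, div_div]

lemma lintegral_fundSol_triangle (p u v w : E3) :
    ∫⁻ x in triangle p v w, ∫⁻ y in triangle p v u, ENNReal.ofReal (fundSol x y)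
      ∂(μHE[2] : Measure E3) ∂(μHE[2] : Measure E3) =
    ENNReal.ofReal (gramRoot v w) * (ENNReal.ofReal (gramRoot v u) *
      (ENNReal.ofReal (1 / (4 * Real.pi)) *
        ∫⁻ x in refTriangle, ∫⁻ y in refTriangle, relKernel u v w (y.1 - x.1, y.2, x.2))) := by
  have hm : Measurable fun z : E3 × E3 => ENNReal.ofReal (fundSol z.1 z.2) :=
    measurable_fundSol.ennreal_ofReal
  have hm_section : ∀ x, Measurable fun y => ENNReal.ofReal (fundSol x y) := by
    unfold fundSol; fun_prop
  have hm_integral : Measurable fun x =>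
      ∫⁻ y in triangle p v u, ENNReal.ofReal (fundSol x y) ∂(μHE[2] : Measure E3) :=
    hm.lintegral_prod_right'
  have hr : Measurable fun q : (ℝ × ℝ) × (ℝ × ℝ) => relKernel u v w (q.2.1 - q.1.1, q.2.2, q.1.2) :=
    (measurable_relKernel u v w).comp (by fun_prop)
  have hr_section : ∀ x : ℝ × ℝ,
      Measurable fun y : ℝ × ℝ => relKernel u v w (y.1 - x.1, y.2, x.2) :=
    fun x => (measurable_relKernel u v w).comp (by fun_prop)
  have inner_integral : ∀ x : ℝ × ℝ,
      ∫⁻ y in triangle p v u, ENNReal.ofReal (fundSol (chi p v w x) y) ∂(μHE[2] : Measure E3) =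
      ENNReal.ofReal (gramRoot v u) * (ENNReal.ofReal (1 / (4 * Real.pi)) *
        ∫⁻ y in refTriangle, relKernel u v w (y.1 - x.1, y.2, x.2)) := by
    intro x
    rw [lintegral_triangle p v u (hm_section (chi p v w x))]
    simp_rw [ofReal_fundSol_chi]
    rw [lintegral_const_mul _ (hr_section x)]
  rw [lintegral_triangle p v w hm_integral]
  simp_rw [inner_integral]
  have hr_integral := hr.lintegral_prod_right' (ν := volume.restrict refTriangle)
  rw [lintegral_const_mul _ (hr_integral.const_mul _), lintegral_const_mul _ hr_integral]

lemma EdgeCone.lintegral_fundSol {u v w : E3} (h : EdgeCone u v w) (p : E3) :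
    ∫⁻ z, ENNReal.ofReal (fundSol z.1 z.2)
      ∂(((μHE[2] : Measure E3).restrict (triangle p v w)).prod
        ((μHE[2] : Measure E3).restrict (triangle p v u))) =
    ENNReal.ofReal (gramRoot v u * gramRoot v w / (24 * Real.pi) * ∑ j, edgeIntegral u v w j) := by
  rw [lintegral_prod _ measurable_fundSol.ennreal_ofReal.aemeasurable,
    lintegral_fundSol_triangle, h.lintegral_relKernel, ← ENNReal.ofReal_mul (by positivity),
    ← ENNReal.ofReal_mul (gramRoot_nonneg v u), ← ENNReal.ofReal_mul (gramRoot_nonneg v w)]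
  congr 1
  field_simp
  ring

theorem EdgeCone.integrable_fundSol {u v w : E3} (h : EdgeCone u v w) (p : E3) :
    Integrable (fun z : E3 × E3 => fundSol z.1 z.2)
      (((μHE[2] : Measure E3).restrict (triangle p v w)).prod
        ((μHE[2] : Measure E3).restrict (triangle p v u))) := by
  refine ⟨measurable_fundSol.aestronglyMeasurable, ?_⟩
  rw [hasFiniteIntegral_iff_ofReal (ae_of_all _ fun z => fundSol_nonneg _ _),
    h.lintegral_fundSol p]
  exact ENNReal.ofReal_lt_top

theorem EdgeCone.singleLayer_eq {u v w : E3} (h : EdgeCone u v w) (p : E3) :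
    singleLayer (triangle p v w) (triangle p v u) =
      gramRoot v u * gramRoot v w / (24 * Real.pi) * ∑ j, edgeIntegral u v w j := by
  have sum_nonneg : 0 ≤ ∑ j, edgeIntegral u v w j :=
    Finset.sum_nonneg fun j _ => edgeIntegral_nonneg u v w j
  have factor_nonneg : 0 ≤ gramRoot v u * gramRoot v w / (24 * Real.pi) :=
    div_nonneg (mul_nonneg (gramRoot_nonneg v u) (gramRoot_nonneg v w)) (by positivity)
  refine (integral_prod _ (h.integrable_fundSol p)).symm.trans ?_
  rw [integral_eq_lintegral_of_nonneg_ae (ae_of_all _ fun z => fundSol_nonneg _ _)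
    measurable_fundSol.aestronglyMeasurable, h.lintegral_fundSol p,
    ENNReal.toReal_ofReal (mul_nonneg factor_nonneg sum_nonneg)]

end SingleLayerEdge

theorem mainTheorem2 :
    -- the closed form of `H(a, b, c) = ∫₀¹ h`
    (∀ a b c : E3, c ≠ 0 →
      (a ≠ 0 → 0 ≤ disc a b c) ∧
      (Regular a b c →
        IntervalIntegrable (hFun a b c) volume 0 1 ∧ hIntegral a b c = hClosed a b c)) ∧
    -- two triangles `τ`, `σ` whose intersection is exactly the common edge from `p` to `p + v`
    (∀ p u v w : E3, gramRoot v u ≠ 0 → gramRoot v w ≠ 0 →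
      closedTriangle p v u ∩ closedTriangle p v w = segment ℝ p (p + v) →
      -- the single layer integral
      (Integrable (fun z : E3 × E3 => fundSol z.1 z.2)
          (((μHE[2] : Measure E3).restrict (triangle p v w)).prod
            ((μHE[2] : Measure E3).restrict (triangle p v u))) ∧
        (∀ j, IntegrableOn (edgeIntegrand u v w j) unitSquare) ∧
        singleLayer (triangle p v w) (triangle p v u) =
          gramRoot v u * gramRoot v w / (24 * Real.pi) * ∑ j, edgeIntegral u v w j) ∧
      -- the closed form of the integrals `I_j`, wherever its logarithm is defined
      (∀ j, LogDefined u v w j → edgeIntegral u v w j = edgeFormula hClosed u v w j) ∧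
      -- the same formula with `H` as an integral, wherever its integrand has no pole
      (∀ j, RegularPair u v w j → edgeIntegral u v w j = edgeFormula hIntegral u v w j) ∧
      -- the logarithms are defined unless `p` lies between the two opposite vertices,
      -- and for triangles that are not coplanar there are no poles
      (p ∉ segment ℝ (p + v + u) (p + v + w) → ∀ j, LogDefined u v w j) ∧
      (LinearIndependent ℝ ![u, v, w] → ∀ j, RegularPair u v w j)) := by
  refine ⟨fun a b c hc => ⟨fun ha => disc_nonneg ha b hc, hIntegral_of_regular hc⟩, ?_⟩
  intro p u v w hu hw hint
  have h := edgeCone_of_inter hu hw hint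
  exact ⟨⟨h.integrable_fundSol p, h.integrableOn_edgeIntegrand, h.singleLayer_eq p⟩,
    fun _ => h.edgeIntegral_eq, fun _ => h.edgeIntegral_eq_of_regularPair, h.logDefined,
    fun hl j => ⟨regular_par h hl j, regular_par' h hl j⟩⟩
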